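/- Let $d_x\ge 0$, $d_y\ge 1$, and let $f:\mathbb R^{d_x}\times\mathbb R^{d_y}\to\mathbb R$ be twice differentiable. Norms are Euclidean for vectors and spectral for matrices. Suppose there are $\ell,\rho,\mu>0$ such that for all $x,x',y,y'$ * $\|\nabla f(x,y)-\nabla f(x',y')\|^2\le \ell^2(\|x-x'\|^2+\|y-y'\|^2)$; * $\|\nabla^2 f(x,y)-\nabla^2 f(x',y')\|^2\le \rho^2(\|x-x'\|^2+\|y-y'\|^2)$; * $f(x,y)\le f(x,y')+\nabla_y f(x,y')^\top(y-y')-\frac{\mu}{2}\|y-y'\|^2$; * $P(x)=\max_{y} f(x,y)$ satisfies $P^*=\inf_x P(x)>-\infty$. Put $\kappa=\ell/\mu$, $M=4\sqrt2\,\kappa^3\rho$, $y^*(x)=\arg\max_y f(x,y)$ and $S(x,y)=\nabla^2_{xx}f-\nabla^2_{xy}f\,(\nabla^2_{yy}f)^{-1}\nabla^2_{yx}f$ (all at $(x,y)$). A point $(x^*,y^*)$ is a *local minimax point* of $f$ if there are $\delta_0>0$ and a function $h$, positive on $(0,\delta_0]$ and with $h(\delta)\to0$ as $\delta\downarrow0$,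 such that $f(x^*,y)\le f(x^*,y^*)\le \max_{y'}f(x,y')$ for all $\delta\in(0,\delta_0]$, all $x$ with $\|x-x^*\|\le h(\delta)$ and all $y$. Suppose that $f$ is $(\alpha,\beta,\gamma)$-*strict-minimax* for some $\alpha,\beta,\gamma>0$: every $(x,y)$ satisfies $\|\nabla f(x,y)\|>\alpha$, or $\lambda_{\min}(S(x,y))<-\beta$, or $\|x-x^*\|^2+\|y-y^*\|^2\le\gamma^2$ for some local minimax point $(x^*,y^*)$ of $f$. $\mathrm{AGD}(h,y_0,K,\eta,\theta)$ sets $\tilde y_0=y_0$, iterates $y_{k+1}=\tilde y_k-\eta\nabla h(\tilde y_k)$, $\tilde y_{k+1}=y_{k+1}+\theta(y_{k+1}-y_k)$, and returns $y_K$; below always $\eta=1/\ell$ and $\theta=\frac{\sqrt\kappa-1}{\sqrt\kappa+1}$. $\mathrm{MCN}$ with input $x_0\in\mathbb R^{d_x}$, $T$, $(K_t)$, $\varepsilon'$ does the following for $t=0,\dots,T-1$: it computes $y_t=\mathrm{AGD}(-f(x_t,\cdot),y_{t-1},K_t,\eta,\theta)$ (with $y_{-1}=0$) and a global minimizer $s_t^*$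 of $s\mapsto \nabla_xf(x_t,y_t)^\top s+\frac12 s^\top S(x_t,y_t)s+\frac M6\|s\|^3$; it leaves the loop if $\|s_t^*\|\le\frac12\sqrt{\varepsilon'/M}$, and otherwise sets $x_{t+1}=x_t+s_t^*$. Its output is $\hat x=x_t+s_t^*$ for the last round $t$ performed. Let $$\varepsilon=\min\Big\{\frac\alpha3,\frac{\beta^2}{8\kappa^3\rho}\Big\},\quad \varepsilon'=2^{-2.5}\varepsilon,\quad \tilde\varepsilon=\min\Big\{\frac{\varepsilon}{192\,\ell},\frac{\sqrt{M\varepsilon}}{48\rho}\Big\},\quad \tilde\varepsilon'=\min\Big\{\frac{\varepsilon'}{192\,\ell},\frac{\sqrt{M\varepsilon'}}{48\rho}\Big\}.$$ For any $x_0$ run $\mathrm{MCN}$ with input $x_0,T,(K_t),\varepsilon'$, where $T=\lceil192(P(x_0)-P^*)\sqrt M\,\varepsilon'^{-1.5}\rceil+1$, $$K_0=\Big\lceil2\sqrt\kappa\log\Big(\frac{\sqrt{\kappa+1}}{\tilde\varepsilon'}\|y^*(x_0)\|\Big)\Big\rceil,\qquad K_t=\Big\lceil2\sqrt\kappa\log\Big(\frac{\sqrt{\kappa+1}}{\tilde\varepsilon'}\big(\tilde\varepsilon'+\kappa\|s_{t-1}^*\|\big)\Big)\Big\rceil\quad(t\ge1).$$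 Let $\hat x=x_t+s_t^*$ be its output and $\hat y=\mathrm{AGD}(-f(\hat x,\cdot),y_t,\hat K,\eta,\theta)$, where $$\hat K=\left\lceil2\sqrt\kappa\log\left(\frac{\sqrt{\kappa+1}\,\Big(\tilde\varepsilon+\frac{\kappa}{2^{2.25}}\sqrt{\varepsilon/M}\Big)}{\min\big\{\frac{\alpha}{2\ell},\frac{\beta}{8\kappa^2\rho}\big\}}\right)\right\rceil$$ (a negative number of steps, or $\log 0$, means $0$ steps). Then there is a local minimax point $(x^*,y^*)$ of $f$ with $\|x^*-\hat x\|^2+\|y^*-\hat y\|^2\le\gamma^2$. -/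

import Mathlib

open Filter Topology

noncomputable section

namespace MinimaxCubic

/-- `ℝ^d` with its Euclidean norm. -/
abbrev Euc (d : ℕ) : Type := EuclideanSpace ℝ (Fin d)

/-- `ℝ^{dx} × ℝ^{dy}` with the Euclidean norm `‖(x, y)‖² = ‖x‖² + ‖y‖²`. -/
abbrev Joint (dx dy : ℕ) : Type := WithLp 2 (Euc dx × Euc dy)

variable {dx dy : ℕ}

/-- The pair `(x, y)` as a vector of `ℝ^{dx} × ℝ^{dy}`. -/
def pair (x : Euc dx) (y : Euc dy) : Joint dx dy := WithLp.toLp 2 (x, y)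

/-- `f` as a function of the joint variable. -/
def joint (f : Euc dx → Euc dy → ℝ) : Joint dx dy → ℝ := fun z => f z.fst z.snd

/-! Full and partial gradients. -/

/-- `∇ f (x, y)`. -/
def grad (f : Euc dx → Euc dy → ℝ) (x : Euc dx) (y : Euc dy) : Joint dx dy :=
  gradient (joint f) (pair x y)

/-- `∇_x f (x, y)`. -/
def gradX (f : Euc dx → Euc dy → ℝ) (x : Euc dx) (y : Euc dy) : Euc dx := (grad f x y).fst

/-- `∇_y f (x, y)`. -/
def gradY (f : Euc dx → Euc dy → ℝ) (x : Euc dx) (y : Euc dy) : Euc dy := (grad f x y).snd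

/-! The Hessian, as a linear operator (its norm is then the spectral norm), and its blocks. -/

/-- `∇² f (x, y)`: the derivative of the gradient. -/
def hess (f : Euc dx → Euc dy → ℝ) (x : Euc dx) (y : Euc dy) :
    Joint dx dy →L[ℝ] Joint dx dy :=
  fderiv ℝ (gradient (joint f)) (pair x y)

/-- The inclusion `x ↦ (x, 0)`. -/
def inclX (dx dy : ℕ) : Euc dx →L[ℝ] Joint dx dy :=
  ((WithLp.prodContinuousLinearEquiv 2 ℝ (Euc dx) (Euc dy)).symm :
    Euc dx × Euc dy →L[ℝ] Joint dx dy) ∘L ContinuousLinearMap.inl ℝ (Euc dx) (Euc dy)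

/-- The inclusion `y ↦ (0, y)`. -/
def inclY (dx dy : ℕ) : Euc dy →L[ℝ] Joint dx dy :=
  ((WithLp.prodContinuousLinearEquiv 2 ℝ (Euc dx) (Euc dy)).symm :
    Euc dx × Euc dy →L[ℝ] Joint dx dy) ∘L ContinuousLinearMap.inr ℝ (Euc dx) (Euc dy)

/-- The projection `(x, y) ↦ x`. -/
def projX (dx dy : ℕ) : Joint dx dy →L[ℝ] Euc dx := WithLp.fstL 2 ℝ (Euc dx) (Euc dy)

/-- The projection `(x, y) ↦ y`. -/
def projY (dx dy : ℕ) : Joint dx dy →L[ℝ] Euc dy := WithLp.sndL 2 ℝ (Euc dx) (Euc dy)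

/-- The block `∇²_xx f (x, y)`. -/
def hessXX (f : Euc dx → Euc dy → ℝ) (x : Euc dx) (y : Euc dy) : Euc dx →L[ℝ] Euc dx :=
  projX dx dy ∘L hess f x y ∘L inclX dx dy

/-- The block `∇²_xy f (x, y)`, a `dx × dy` matrix. -/
def hessXY (f : Euc dx → Euc dy → ℝ) (x : Euc dx) (y : Euc dy) : Euc dy →L[ℝ] Euc dx :=
  projX dx dy ∘L hess f x y ∘L inclY dx dy

/-- The block `∇²_yx f (x, y)`, a `dy × dx` matrix. -/
def hessYX (f : Euc dx → Euc dy → ℝ) (x : Euc dx) (y : Euc dy) : Euc dx →L[ℝ] Euc dy :=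
  projY dx dy ∘L hess f x y ∘L inclX dx dy

/-- The block `∇²_yy f (x, y)`. -/
def hessYY (f : Euc dx → Euc dy → ℝ) (x : Euc dx) (y : Euc dy) : Euc dy →L[ℝ] Euc dy :=
  projY dx dy ∘L hess f x y ∘L inclY dx dy

/-- The matrix `∇²_xx f - ∇²_xy f (∇²_yy f)⁻¹ ∇²_yx f` at `(x, y)`. -/
def schur (f : Euc dx → Euc dy → ℝ) (x : Euc dx) (y : Euc dy) : Euc dx →L[ℝ] Euc dx :=
  hessXX f x y -
    hessXY f x y ∘L ContinuousLinearMap.inverse (hessYY f x y) ∘L hessYX f x y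

/-- The smallest eigenvalue of a symmetric operator (it is `0` by convention if `d = 0`). -/
def lambdaMin {d : ℕ} (H : Euc d →L[ℝ] Euc d) : ℝ :=
  sInf {lam : ℝ | Module.End.HasEigenvalue (H : Euc d →ₗ[ℝ] Euc d) lam}

/-! The assumptions on `f`. -/

/-- `f` is twice differentiable. -/
def TwiceDifferentiable (f : Euc dx → Euc dy → ℝ) : Prop :=
  Differentiable ℝ (joint f) ∧ Differentiable ℝ (gradient (joint f))

/-- `f` has `ℓ`-Lipschitz gradient. -/
def LipschitzGrad (f : Euc dx → Euc dy → ℝ) (ℓ : ℝ) : Prop :=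
  ∀ (x x' : Euc dx) (y y' : Euc dy),
    ‖grad f x y - grad f x' y'‖ ^ 2 ≤ ℓ ^ 2 * (‖x - x'‖ ^ 2 + ‖y - y'‖ ^ 2)

/-- `f` has `ρ`-Lipschitz Hessian. -/
def LipschitzHess (f : Euc dx → Euc dy → ℝ) (ρ : ℝ) : Prop :=
  ∀ (x x' : Euc dx) (y y' : Euc dy),
    ‖hess f x y - hess f x' y'‖ ^ 2 ≤ ρ ^ 2 * (‖x - x'‖ ^ 2 + ‖y - y'‖ ^ 2)

/-- The differentiable function `f` is `μ`-strongly concave in `y`. -/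
def StronglyConcaveInY (f : Euc dx → Euc dy → ℝ) (μ : ℝ) : Prop :=
  ∀ (x : Euc dx) (y y' : Euc dy),
    f x y ≤ f x y' + inner ℝ (gradY f x y') (y - y') - μ / 2 * ‖y - y'‖ ^ 2

/-- The primal function `P(x) = max_y f(x, y)`. -/
def primal (f : Euc dx → Euc dy → ℝ) (x : Euc dx) : ℝ := ⨆ y, f x y

/-- The primal function is bounded from below. -/
def PrimalBddBelow (f : Euc dx → Euc dy → ℝ) : Prop := BddBelow (Set.range (primal f))

/-- `P* = inf_x P(x)`. -/
def primalInf (f : Euc dx → Euc dy → ℝ) : ℝ := ⨅ x, primal f x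

/-- `y*(x) = argmax_y f(x, y)`. -/
def argmaxY (f : Euc dx → Euc dy → ℝ) (x : Euc dx) : Euc dy :=
  Classical.epsilon fun y => ∀ y', f x y' ≤ f x y

/-! Local minimax points and the strict-minimax condition. -/

/-- `(xs, ys)` is a local minimax point of `f`; the radii `h δ` are positive, so that
`closedBall xs (h δ)` is a neighbourhood of `xs`. -/
def IsLocalMinimax (f : Euc dx → Euc dy → ℝ) (xs : Euc dx) (ys : Euc dy) : Prop :=
  ∃ δ₀ : ℝ, 0 < δ₀ ∧ ∃ h : ℝ → ℝ, (∀ δ ∈ Set.Ioc 0 δ₀, 0 < h δ) ∧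
    Tendsto h (𝓝[>] 0) (𝓝 0) ∧
    ∀ δ ∈ Set.Ioc 0 δ₀, ∀ x ∈ Metric.closedBall xs (h δ), ∀ y : Euc dy,
      f xs y ≤ f xs ys ∧ f xs ys ≤ primal f x

/-- `f` is `(α, β, γ)`-strict-minimax. -/
def StrictMinimax (f : Euc dx → Euc dy → ℝ) (α β γ : ℝ) : Prop :=
  0 < α ∧ 0 < β ∧ 0 < γ ∧ ∀ (x : Euc dx) (y : Euc dy),
    α < ‖grad f x y‖ ∨
    lambdaMin (schur f x y) < -β ∨
    ∃ (xs : Euc dx) (ys : Euc dy), IsLocalMinimax f xs ys ∧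
      ‖x - xs‖ ^ 2 + ‖y - ys‖ ^ 2 ≤ γ ^ 2

/-! Accelerated gradient descent. -/

/-- The pair `(y_k, ỹ_k)` of AGD on `h` with step size `η` and momentum `θ`:
`y_{k+1} = ỹ_k - η ∇h(ỹ_k)` and `ỹ_{k+1} = y_{k+1} + θ (y_{k+1} - y_k)`. -/
def agdState {d : ℕ} (h : Euc d → ℝ) (y₀ : Euc d) (η θ : ℝ) : ℕ → Euc d × Euc d
  | 0 => (y₀, y₀)
  | k + 1 =>
    let s := agdState h y₀ η θ k
    let y := s.2 - η • gradient h s.2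
    (y, y + θ • (y - s.1))

/-- The output `y_K` of `AGD(h, y₀, K, η, θ)`. -/
def agd {d : ℕ} (h : Euc d → ℝ) (y₀ : Euc d) (K : ℕ) (η θ : ℝ) : Euc d :=
  (agdState h y₀ η θ K).1

/-- `AGD(-f(x, ·), y₀, K, 1/ℓ, (√κ - 1)/(√κ + 1))`. -/
def agdMax (f : Euc dx → Euc dy → ℝ) (ℓ κ : ℝ) (x : Euc dx) (y₀ : Euc dy) (K : ℕ) : Euc dy :=
  agd (fun y => -f x y) y₀ K (1 / ℓ) ((√κ - 1) / (√κ + 1))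

/-! The Minimax Cubic-Newton algorithm. -/

/-- The cubic model `gᵀ s + ½ sᵀ H s + (M / 6) ‖s‖³`. -/
def cubicModel {d : ℕ} (g : Euc d) (H : Euc d →L[ℝ] Euc d) (M : ℝ) (s : Euc d) : ℝ :=
  inner ℝ g s + 1 / 2 * inner ℝ s (H s) + M / 6 * ‖s‖ ^ 3

/-- `x`, `y`, `s` are the iterates `x_i`, `y_i`, `s_i^*` for `i = 0, …, t` of a run of MCN with
input `x₀`, `T`, `K`, `ε` that leaves its loop in round `t`, so that its output is `x t + s t`.
The exact minimizers `s_i^*` of the cubic models may be any minimizers. -/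
structure IsMCNRun (f : Euc dx → Euc dy → ℝ) (ℓ κ M : ℝ)
    (x₀ : Euc dx) (T : ℕ) (K : ℕ → ℕ) (ε : ℝ)
    (t : ℕ) (x : ℕ → Euc dx) (y : ℕ → Euc dy) (s : ℕ → Euc dx) : Prop where
  round_lt : t < T
  x_zero : x 0 = x₀
  y_zero : y 0 = agdMax f ℓ κ (x 0) 0 (K 0)
  y_succ : ∀ i < t, y (i + 1) = agdMax f ℓ κ (x (i + 1)) (y i) (K (i + 1))
  cubic : ∀ i ≤ t, ∀ v : Euc dx,
    cubicModel (gradX f (x i) (y i)) (schur f (x i) (y i)) M (s i) ≤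
      cubicModel (gradX f (x i) (y i)) (schur f (x i) (y i)) M v
  no_break : ∀ i < t, ¬ ‖s i‖ ≤ 1 / 2 * √(ε / M)
  x_succ : ∀ i < t, x (i + 1) = x i + s i
  leave : ‖s t‖ ≤ 1 / 2 * √(ε / M) ∨ t + 1 = T

/-- `min {C_g ε / ℓ, C_H √(M ε) / ρ}` with `C_g = 1/192` and `C_H = 1/48`. -/
def innerTol (ℓ ρ M ε : ℝ) : ℝ := min (1 / 192 * ε / ℓ) (1 / 48 * √(M * ε) / ρ)

/-- The numbers `K_i` of inner AGD steps of MCN, where `τ` is the accuracy wanted in `y`, `r`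
is the norm of `y*(x₀)` and `s_{i-1}` is the previous step of `x`. -/
def mcnSteps (κ τ r : ℝ) (s : ℕ → Euc dx) : ℕ → ℕ
  | 0 => ⌈2 * √κ * Real.log (√(κ + 1) / τ * r)⌉₊
  | i + 1 => ⌈2 * √κ * Real.log (√(κ + 1) / τ * (τ + κ * ‖s i‖))⌉₊

end MinimaxCubic

end

open MinimaxCubic

/-!
The point returned by the algorithm violates the first two alternatives of the strict-minimax
condition, so that the third one must hold. The reasons are the following.

* Since `f` is strongly concave in `y`, the maximizer `y*(x)` is unique and `κ`-Lipschitz. As it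
  solves `∇_y f (x, y) = 0` and `∇²_yy f` is invertible, it is differentiable, and the chain rule
  gives `∇P(x) = ∇_x f (x, y*(x))` and `∇²P(x) = S(x, y*(x))` (`IsNCSC.hasGradientAt_primal`,
  `IsNCSC.hasFDerivAt_gradX_argmaxY`). The map `S` is `4 κ² ρ`-Lipschitz, hence `∇²P` is
  `M`-Lipschitz.
* AGD contracts an energy by `1 - 1/√κ` in each step (`agd_lyapunov_step`). With the prescribed
  numbers of steps, all `y_i` are within the tolerance `innerTol` of `y*(x_i)`
  (`IsNCSC.run_accuracy`), so that `MCN` is a cubic Newton method for `P` with inexact derivatives.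
* A global minimizer `s` of the cubic model satisfies `g + H s + (M / 2) ‖s‖ s = 0` and
  `H + (M / 2) ‖s‖ ⪰ 0`. A step longer than `½ √(ε' / M)` therefore decreases `P` by a fixed amount
  (`IsNCSC.primal_add_le_sub`), which can happen fewer than `T` times. After a short step, `∇P` is
  small and `∇²P` is almost positive semidefinite (`IsNCSC.stationary_of_short_step`).
* The final call of AGD brings `ŷ` so close to `y*(x̂)` that this carries over to `∇f` and `S` at
  `(x̂, ŷ)`.

The tolerance controls the error of `S` only by `4 κ² ρ · innerTol`, which for large `ε'` exceeds
the order `√(M ε')` natural for the cubic Newton method by a power of `κ`. The a priori bounds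
`S ⪰ -ℓ` and `‖S‖ ≤ 2 κ ℓ` make up for this: the former holds because `∇²_yy f` is
negative definite.
-/

namespace MinimaxCubic

/-! ### Taylor bounds -/

theorem hasDerivAt_line {E : Type*} [NormedAddCommGroup E] [NormedSpace ℝ E] (x s : E) (t : ℝ) :
    HasDerivAt (fun t : ℝ => x + t • s) s t := by
  simpa using ((hasDerivAt_id t).smul_const s).const_add x

theorem norm_taylor_one_le {E F : Type*} [NormedAddCommGroup E] [NormedSpace ℝ E]
    [NormedAddCommGroup F] [NormedSpace ℝ F] {φ : E → F} {D : E → E →L[ℝ] F} {L : ℝ}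
    (hφ : ∀ x, HasFDerivAt φ (D x) x) (hD : ∀ x x', ‖D x - D x'‖ ≤ L * ‖x - x'‖) (x s : E) :
    ‖φ (x + s) - φ x - D x s‖ ≤ L / 2 * ‖s‖ ^ 2 := by
  have hder : ∀ t : ℝ, HasDerivAt (fun t : ℝ => φ (x + t • s) - φ x - t • D x s)
      (D (x + t • s) s - D x s) t := fun t => by
    have h1 := (hφ (x + t • s)).comp_hasDerivAt t (hasDerivAt_line x s t)
    have h2 : HasDerivAt (fun t : ℝ => t • D x s) (D x s) t := by
      simpa using (hasDerivAt_id t).smul_const (D x s)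
    exact (h1.sub_const _).sub h2
  have hB : ∀ t : ℝ, HasDerivAt (fun t : ℝ => L / 2 * ‖s‖ ^ 2 * t ^ 2) (L * ‖s‖ ^ 2 * t) t :=
    fun t => by
      have := ((hasDerivAt_id t).pow 2).const_mul (L / 2 * ‖s‖ ^ 2)
      refine this.congr_deriv ?_
      simp
      ring
  have key := image_norm_le_of_norm_deriv_right_le_deriv_boundary (a := 0) (b := 1)
    (fun t _ => (hder t).continuousAt.continuousWithinAt)
    (fun t _ => (hder t).hasDerivWithinAt) (by simp) hB (fun t ht => ?_)
    (Set.right_mem_Icc.2 zero_le_one)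
  · simpa using key
  · rw [← _root_.sub_apply]
    refine (ContinuousLinearMap.le_opNorm _ _).trans ?_
    have := hD (x + t • s) x
    rw [add_sub_cancel_left, norm_smul, Real.norm_of_nonneg ht.1] at this
    nlinarith [norm_nonneg s]

theorem taylor_two_le {E : Type*} [NormedAddCommGroup E] [InnerProductSpace ℝ E]
    [CompleteSpace E] {φ : E → ℝ} {G : E → E} {D : E → E →L[ℝ] E} {L : ℝ}
    (hφ : ∀ x, HasGradientAt φ (G x) x) (hG : ∀ x, HasFDerivAt G (D x) x)
    (hD : ∀ x x', ‖D x - D x'‖ ≤ L * ‖x - x'‖) (x s : E) :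
    φ (x + s) ≤ φ x + inner ℝ (G x) s + 1 / 2 * inner ℝ s (D x s) + L / 6 * ‖s‖ ^ 3 := by
  have hder : ∀ t : ℝ, HasDerivAt (fun t : ℝ => φ (x + t • s)) (inner ℝ (G (x + t • s)) s) t :=
    fun t => by
      have := (hφ (x + t • s)).hasFDerivAt.comp_hasDerivAt t (hasDerivAt_line x s t)
      rwa [InnerProductSpace.toDual_apply_apply] at this
  have hB : ∀ t : ℝ, HasDerivAt (fun t : ℝ => φ x + t * inner ℝ (G x) s +
      t ^ 2 * (1 / 2 * inner ℝ s (D x s)) + t ^ 3 * (L / 6 * ‖s‖ ^ 3))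
      (inner ℝ (G x) s + t * inner ℝ s (D x s) + t ^ 2 * (L / 2 * ‖s‖ ^ 3)) t :=
    fun t => by
      have h1 := (hasDerivAt_id t).mul_const (inner ℝ (G x) s)
      have h2 := ((hasDerivAt_id t).pow 2).mul_const (1 / 2 * inner ℝ s (D x s))
      have h3 := ((hasDerivAt_id t).pow 3).mul_const (L / 6 * ‖s‖ ^ 3)
      refine (((h1.const_add (φ x)).add h2).add h3).congr_deriv ?_
      simp
      ring
  have key := image_le_of_deriv_right_le_deriv_boundary (a := 0) (b := 1)
    (fun t _ => (hder t).continuousAt.continuousWithinAt)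
    (fun t _ => (hder t).hasDerivWithinAt) (by simp)
    (fun t _ => (hB t).continuousAt.continuousWithinAt)
    (fun t _ => (hB t).hasDerivWithinAt) (fun t ht => ?_)
    (Set.right_mem_Icc.2 zero_le_one)
  · simpa using key
  · have h1 := norm_taylor_one_le hG hD x (t • s)
    have h2 := real_inner_le_norm (G (x + t • s) - G x - D x (t • s)) s
    rw [norm_smul, Real.norm_of_nonneg ht.1, map_smul] at h1
    rw [inner_sub_left, inner_sub_left, map_smul, inner_smul_left, real_inner_comm] at h2
    have h3 := mul_le_mul_of_nonneg_right h1 (norm_nonneg s)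
    simp only [conj_trivial] at h2
    rw [real_inner_comm s (D x s)] at h2
    rw [real_inner_comm]
    linarith

/-- The descent lemma. -/
theorem le_add_of_lipschitz_gradient {E : Type*} [NormedAddCommGroup E] [InnerProductSpace ℝ E]
    [CompleteSpace E] {φ : E → ℝ} {G : E → E} {L : ℝ}
    (hφ : ∀ x, HasGradientAt φ (G x) x) (hG : ∀ x x', ‖G x - G x'‖ ≤ L * ‖x - x'‖) (x s : E) :
    φ (x + s) ≤ φ x + inner ℝ (G x) s + L / 2 * ‖s‖ ^ 2 := by
  have h := norm_taylor_one_le (fun x => (hφ x).hasFDerivAt) (L := L)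
    (fun x x' => by rw [← map_sub, LinearIsometryEquiv.norm_map]; exact hG x x') x s
  have h' := (Real.le_norm_self _).trans h
  rw [InnerProductSpace.toDual_apply_apply] at h'
  linarith

/-! ### Minimizers of the cubic model -/

section CubicModel

variable {d : ℕ} {g : Euc d} {H : Euc d →L[ℝ] Euc d} {M : ℝ} {s : Euc d}

/-- The first-order condition at a minimizer of the cubic model. -/
theorem cubicModel_stationary (hH : ∀ u v, inner ℝ (H u) v = inner ℝ u (H v))
    (hs : ∀ v, cubicModel g H M s ≤ cubicModel g H M v) :
    g + H s + (M / 2 * ‖s‖) • s = 0 := by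
  have h1 : HasFDerivAt (fun v : Euc d => ‖v‖ ^ 3) ((3 * ‖s‖) • innerSL ℝ s) s := by
    have := hasFDerivAt_norm_rpow s (p := 3) (by norm_num)
    norm_num at this
    exact_mod_cast this
  have h2 := ((innerSL ℝ g).hasFDerivAt (x := s)).add
    ((((hasFDerivAt_id s).inner ℝ H.hasFDerivAt).const_mul (1 / 2 : ℝ)))
  have h3 := h2.add (h1.const_mul (M / 6))
  have hmin : IsLocalMin (cubicModel g H M) s := Eventually.of_forall hs
  have h0 := hmin.hasFDerivAt_eq_zero (f' := _) h3
  refine ext_inner_right ℝ fun v => ?_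
  have := congrArg (fun A : Euc d →L[ℝ] ℝ => A v) h0
  simp at this
  rw [inner_add_left, inner_add_left, inner_smul_left, inner_zero_left]
  have e := hH s v
  have e2 := real_inner_comm v (H s)
  simp only [conj_trivial]
  linarith

/-- An exact expansion of the cubic model at a stationary point, whose last term vanishes for steps
that stay on the sphere of radius `‖s‖`. -/
theorem cubicModel_sub (hH : ∀ u v, inner ℝ (H u) v = inner ℝ u (H v))
    (hs : g + H s + (M / 2 * ‖s‖) • s = 0) (v : Euc d) :
    cubicModel g H M (s + v) - cubicModel g H M s =
      1 / 2 * (inner ℝ v (H v) + M / 2 * ‖s‖ * ‖v‖ ^ 2) +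
        M / 6 * ((‖s + v‖ - ‖s‖) ^ 2 * (‖s + v‖ + ‖s‖ / 2)) := by
  have h1 := congrArg (fun w => inner ℝ w v) hs
  simp only [inner_add_left, inner_smul_left, inner_zero_left, conj_trivial] at h1
  have h2 := norm_add_sq_real s v
  have h3 := hH s v
  have h4 := real_inner_comm v (H s)
  simp only [cubicModel, map_add, inner_add_left, inner_add_right]
  have h5 : ‖s + v‖ ^ 3 = ‖s‖ ^ 3 + 3 / 2 * ‖s‖ * (‖s + v‖ ^ 2 - ‖s‖ ^ 2) +
    (‖s + v‖ - ‖s‖) ^ 2 * (‖s + v‖ + ‖s‖ / 2) := by ring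
  rw [h5, h2]
  linear_combination h1 - (1 / 2) * h4 - (1 / 2) * h3

/-- Global minimizers of the cubic model satisfy `H + (M / 2) ‖s‖ I ⪰ 0`. Comparing `s` with the
other points of the sphere of radius `‖s‖` gives this in every direction that is not orthogonal
to `s`; orthogonal directions are limits of these. -/
theorem cubicModel_curvature (hH : ∀ u v, inner ℝ (H u) v = inner ℝ u (H v))
    (hs : ∀ v, cubicModel g H M s ≤ cubicModel g H M v) (v : Euc d) :
    0 ≤ inner ℝ v (H v) + M / 2 * ‖s‖ * ‖v‖ ^ 2 := by
  have hst := cubicModel_stationary hH hs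
  have key : ∀ w, 0 ≤ 1 / 2 * (inner ℝ w (H w) + M / 2 * ‖s‖ * ‖w‖ ^ 2) +
        M / 6 * ((‖s + w‖ - ‖s‖) ^ 2 * (‖s + w‖ + ‖s‖ / 2)) := fun w => by
    rw [← cubicModel_sub hH hst]
    linarith [hs (s + w)]
  have hcase : ∀ w, inner ℝ s w ≠ 0 → 0 ≤ inner ℝ w (H w) + M / 2 * ‖s‖ * ‖w‖ ^ 2 := fun w hw => by
    have hw0 : w ≠ 0 := by rintro rfl; simp at hw
    have hn : 0 < ‖w‖ := norm_pos_iff.2 hw0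
    -- The second intersection of the line `s + ℝ w` with the sphere of radius `‖s‖`.
    set t : ℝ := -2 * inner ℝ s w / ‖w‖ ^ 2 with ht
    have ht0 : t ≠ 0 := by
      rw [ht]; positivity
    have hnorm : ‖s + t • w‖ = ‖s‖ := by
      rw [← sq_eq_sq₀ (norm_nonneg _) (norm_nonneg _), norm_add_sq_real, inner_smul_right,
        norm_smul, mul_pow, Real.norm_eq_abs, sq_abs, ht]
      field_simp
      ring
    have := key (t • w)
    rw [hnorm, map_smul, inner_smul_left, inner_smul_right, norm_smul, mul_pow, Real.norm_eq_abs,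
      sq_abs] at this
    simp only [conj_trivial, sub_self] at this
    have h2 : 0 < t ^ 2 := by positivity
    by_contra hneg
    push Not at hneg
    nlinarith
  rcases eq_or_ne s 0 with rfl | hs0
  · have hlim : Tendsto (fun t : ℝ => 1 / 2 * inner ℝ v (H v) + t * (M / 6 * ‖v‖ ^ 3)) (𝓝[>] 0)
        (𝓝 (1 / 2 * inner ℝ v (H v) + 0 * (M / 6 * ‖v‖ ^ 3))) :=
      ((continuous_const.add (continuous_id.mul continuous_const)).tendsto 0).mono_left
        nhdsWithin_le_nhds
    have h0 := ge_of_tendsto hlim (by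
      filter_upwards [self_mem_nhdsWithin] with t ht
      have ht : 0 < t := ht
      have := key (t • v)
      rw [map_smul, inner_smul_left, inner_smul_right, zero_add, norm_smul,
        Real.norm_of_nonneg ht.le, norm_zero] at this
      simp only [conj_trivial] at this
      have h3 : 0 ≤ t ^ 2 * (1 / 2 * inner ℝ v (H v) + t * (M / 6 * ‖v‖ ^ 3)) := by linarith
      exact nonneg_of_mul_nonneg_right h3 (by positivity))
    simp at h0 ⊢
    exact h0
  · by_cases hv : inner ℝ s v = 0
    · have hlim : Tendsto (fun t : ℝ => inner ℝ (v + t • s) (H (v + t • s)) +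
          M / 2 * ‖s‖ * ‖v + t • s‖ ^ 2) (𝓝[>] 0)
          (𝓝 (inner ℝ (v + (0 : ℝ) • s) (H (v + (0 : ℝ) • s)) +
            M / 2 * ‖s‖ * ‖v + (0 : ℝ) • s‖ ^ 2)) :=
        (Continuous.tendsto (by fun_prop) 0).mono_left nhdsWithin_le_nhds
      have h0 := ge_of_tendsto hlim (by
        filter_upwards [self_mem_nhdsWithin] with t ht
        have ht : 0 < t := ht
        refine hcase _ ?_
        rw [inner_add_right, hv, inner_smul_right, real_inner_self_eq_norm_sq, zero_add]
        have := norm_pos_iff.2 hs0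
        positivity)
      simpa using h0
    · exact hcase v hv

/-- The value of the cubic model at a stationary point. -/
theorem cubicModel_eq (hst : g + H s + (M / 2 * ‖s‖) • s = 0) :
    cubicModel g H M s = -(1 / 2) * inner ℝ s (H s) - M / 3 * ‖s‖ ^ 3 := by
  have h1 := congrArg (fun w => inner ℝ w s) hst
  simp only [inner_add_left, inner_smul_left, inner_zero_left, conj_trivial,
    real_inner_self_eq_norm_sq] at h1
  rw [cubicModel]
  linear_combination h1 + real_inner_comm (H s) s

end CubicModel

/-! ### Accelerated gradient descent -/

section AGD

variable {d : ℕ} {h : Euc d → ℝ} {ys : Euc d} {ℓ μ κ : ℝ}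

/-- One step of AGD from the state `(y, w)` to `(y', w')`, where `r = √κ`: the energy
`h y - h y* + μ/2 ‖w + r (w - y) - y*‖²` contracts by the factor `1 - 1/r`. -/
theorem agd_lyapunov_step {r : ℝ} (hr : 1 ≤ r) (hμ : 0 < μ) (hℓ : ℓ = r ^ 2 * μ)
    (hsc : ∀ y y', h y' + inner ℝ (gradient h y') (y - y') + μ / 2 * ‖y - y'‖ ^ 2 ≤ h y)
    (hsm : ∀ y v, h (y + v) ≤ h y + inner ℝ (gradient h y) v + ℓ / 2 * ‖v‖ ^ 2)
    {y w y' w' : Euc d} (hy' : y' = w - (1 / ℓ) • gradient h w)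
    (hw' : w' = y' + ((r - 1) / (r + 1)) • (y' - y)) :
    r * (h y' - h ys + μ / 2 * ‖w' + r • (w' - y') - ys‖ ^ 2) ≤
      (r - 1) * (h y - h ys + μ / 2 * ‖w + r • (w - y) - ys‖ ^ 2) := by
  have hr0 : 0 < r := by linarith
  have hℓ0 : 0 < ℓ := by rw [hℓ]; positivity
  set g := gradient h w with hg
  set p := w - ys with hp
  set q := w - y with hq
  have e1 : w + r • (w - y) - ys = p + r • q := by rw [hp, hq]; module
  have e2 : w' + r • (w' - y') - ys = p + (r - 1) • q - (1 / (r * μ)) • g := by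
    have h1 : w' + r • (w' - y') - ys = y + r • (y' - y) - ys := by
      rw [hw', show y' + ((r - 1) / (r + 1)) • (y' - y) +
        r • (y' + ((r - 1) / (r + 1)) • (y' - y) - y') - ys =
        y' + ((r - 1) / (r + 1) * (r + 1)) • (y' - y) - ys by module,
        div_mul_cancel₀ _ (by positivity)]
      module
    have h2 : 1 / (r * μ) = r * (1 / ℓ) := by rw [hℓ]; field_simp
    rw [h1, hy', h2, hp, hq]
    module
  -- The descent lemma for the gradient step.
  have i1 : h y' ≤ h w - 1 / (2 * ℓ) * ‖g‖ ^ 2 := by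
    have := hsm w (-((1 / ℓ) • g))
    rw [← sub_eq_add_neg, ← hg, ← hy', inner_neg_right, inner_smul_right,
      real_inner_self_eq_norm_sq, norm_neg, norm_smul, mul_pow, Real.norm_eq_abs, sq_abs] at this
    refine this.trans (le_of_eq ?_)
    field_simp
    ring
  have i2 := hsc ys w
  have i3 := hsc y w
  rw [← neg_sub w ys, inner_neg_right, norm_neg, ← hp, ← hg] at i2
  rw [← neg_sub w y, inner_neg_right, norm_neg, ← hq, ← hg] at i3
  have e3 : ‖p + r • q‖ ^ 2 = ‖p‖ ^ 2 + 2 * r * inner ℝ p q + r ^ 2 * ‖q‖ ^ 2 := by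
    rw [norm_add_sq_real, inner_smul_right, norm_smul, mul_pow, Real.norm_eq_abs, sq_abs]
    ring
  have e4 : r * (μ / 2 * ‖p + (r - 1) • q - (1 / (r * μ)) • g‖ ^ 2) =
      r * (μ / 2 * (‖p‖ ^ 2 + 2 * (r - 1) * inner ℝ p q + (r - 1) ^ 2 * ‖q‖ ^ 2))
        - (inner ℝ g p + (r - 1) * inner ℝ g q) + r * (1 / (2 * ℓ) * ‖g‖ ^ 2) := by
    rw [norm_sub_sq_real, norm_add_sq_real, inner_smul_right, inner_smul_right, inner_add_left,
      inner_smul_left, norm_smul, norm_smul, mul_pow, mul_pow, Real.norm_eq_abs, sq_abs,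
      Real.norm_eq_abs, sq_abs, real_inner_comm p g, real_inner_comm q g, hℓ]
    simp only [conj_trivial]
    field_simp
  rw [e1, e2, mul_add, e4, e3]
  have t1 := mul_le_mul_of_nonneg_left i1 hr0.le
  have t3 := mul_le_mul_of_nonneg_left i3 (sub_nonneg.2 hr)
  have t4 : 0 ≤ μ / 2 * ((r - 1) * (r + 1) * ‖q‖ ^ 2) := by
    have := sub_nonneg.2 hr
    positivity
  linarith

/-- Nesterov's rate. The energy is at least `μ/2 ‖y_K - y*‖²` at the end and at most
`(ℓ + μ)/2 ‖y₀ - y*‖²` at the start. -/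
theorem agd_dist_sq_le (hκ : 1 ≤ κ) (hμ : 0 < μ) (hℓ : ℓ = κ * μ)
    (hsc : ∀ y y', h y' + inner ℝ (gradient h y') (y - y') + μ / 2 * ‖y - y'‖ ^ 2 ≤ h y)
    (hsm : ∀ y v, h (y + v) ≤ h y + inner ℝ (gradient h y) v + ℓ / 2 * ‖v‖ ^ 2)
    (hys : gradient h ys = 0) (y₀ : Euc d) (K : ℕ) :
    ‖agd h y₀ K (1 / ℓ) ((√κ - 1) / (√κ + 1)) - ys‖ ^ 2 ≤
      (κ + 1) * (1 - 1 / √κ) ^ K * ‖y₀ - ys‖ ^ 2 := by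
  have hr : 1 ≤ √κ := Real.one_le_sqrt.2 hκ
  have hr0 : 0 < √κ := by linarith
  have hr2 : √κ ^ 2 = κ := Real.sq_sqrt (by linarith)
  have ha : 0 ≤ 1 - 1 / √κ := by
    rw [sub_nonneg, div_le_one hr0]; exact hr
  have energy : ∀ k, h (agdState h y₀ (1 / ℓ) ((√κ - 1) / (√κ + 1)) k).1 - h ys +
      μ / 2 * ‖(agdState h y₀ (1 / ℓ) ((√κ - 1) / (√κ + 1)) k).2 +
        √κ • ((agdState h y₀ (1 / ℓ) ((√κ - 1) / (√κ + 1)) k).2 -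
          (agdState h y₀ (1 / ℓ) ((√κ - 1) / (√κ + 1)) k).1) - ys‖ ^ 2 ≤
      (1 - 1 / √κ) ^ k * (h y₀ - h ys + μ / 2 * ‖y₀ - ys‖ ^ 2) := by
    intro k
    induction k with
    | zero => simp [agdState]
    | succ k ih =>
      have step := agd_lyapunov_step (h := h) (ys := ys) (μ := μ) (ℓ := ℓ) hr hμ
        (by rw [hr2, hℓ]) hsc hsm
        (y := (agdState h y₀ (1 / ℓ) ((√κ - 1) / (√κ + 1)) k).1)
        (w := (agdState h y₀ (1 / ℓ) ((√κ - 1) / (√κ + 1)) k).2)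
        (y' := (agdState h y₀ (1 / ℓ) ((√κ - 1) / (√κ + 1)) (k + 1)).1)
        (w' := (agdState h y₀ (1 / ℓ) ((√κ - 1) / (√κ + 1)) (k + 1)).2) rfl rfl
      have h1 := mul_le_mul_of_nonneg_left ih ha
      rw [pow_succ' (1 - 1 / √κ) k, mul_assoc]
      refine le_trans ?_ h1
      refine le_of_mul_le_mul_left (step.trans (le_of_eq ?_)) hr0
      rw [← mul_assoc, mul_sub, mul_one, mul_one_div_cancel hr0.ne']
  have h0 := hsc (agdState h y₀ (1 / ℓ) ((√κ - 1) / (√κ + 1)) K).1 ys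
  have h1 := hsm ys (y₀ - ys)
  rw [hys, inner_zero_left] at h0 h1
  rw [add_sub_cancel, hℓ] at h1
  have hpow := pow_nonneg ha K
  have h2 : (1 - 1 / √κ) ^ K * (h y₀ - h ys + μ / 2 * ‖y₀ - ys‖ ^ 2) ≤
      (1 - 1 / √κ) ^ K * (μ / 2 * ((κ + 1) * ‖y₀ - ys‖ ^ 2)) :=
    mul_le_mul_of_nonneg_left (by linarith) hpow
  have h3 := energy K
  have h4 : 0 ≤ μ / 2 * ‖(agdState h y₀ (1 / ℓ) ((√κ - 1) / (√κ + 1)) K).2 +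
        √κ • ((agdState h y₀ (1 / ℓ) ((√κ - 1) / (√κ + 1)) K).2 -
          (agdState h y₀ (1 / ℓ) ((√κ - 1) / (√κ + 1)) K).1) - ys‖ ^ 2 := by positivity
  rw [agd]
  have hμ2 : 0 < μ / 2 := by positivity
  refine le_of_mul_le_mul_left ?_ hμ2
  linarith

/-- AGD reaches accuracy `τ` after `2 √κ log (√(κ + 1) R / τ)` steps from a point at distance at
most `R`. If `R ≤ 0` or the logarithm is negative, the claim holds with `0` steps. -/
theorem agd_dist_le (hκ : 1 ≤ κ) (hμ : 0 < μ) (hℓ : ℓ = κ * μ)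
    (hsc : ∀ y y', h y' + inner ℝ (gradient h y') (y - y') + μ / 2 * ‖y - y'‖ ^ 2 ≤ h y)
    (hsm : ∀ y v, h (y + v) ≤ h y + inner ℝ (gradient h y) v + ℓ / 2 * ‖v‖ ^ 2)
    (hys : gradient h ys = 0) {y₀ : Euc d} {K : ℕ} {R τ : ℝ} (hτ : 0 < τ)
    (hR : ‖y₀ - ys‖ ≤ R) (hK : 2 * √κ * Real.log (√(κ + 1) / τ * R) ≤ K) :
    ‖agd h y₀ K (1 / ℓ) ((√κ - 1) / (√κ + 1)) - ys‖ ≤ τ := by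
  have hmain := agd_dist_sq_le hκ hμ hℓ hsc hsm hys y₀ K
  have hr : 1 ≤ √κ := Real.one_le_sqrt.2 hκ
  have hr0 : 0 < √κ := by linarith
  have ha : 0 ≤ 1 - 1 / √κ := by
    rw [sub_nonneg, div_le_one hr0]; exact hr
  have hR0 : 0 ≤ R := (norm_nonneg _).trans hR
  rw [← sq_le_sq₀ (norm_nonneg _) hτ.le]
  refine hmain.trans ?_
  have hk1 : 0 < κ + 1 := by linarith
  have hb : (1 - 1 / √κ) ^ K ≤ Real.exp (-(K / √κ)) := by
    have h1 : 1 - 1 / √κ ≤ Real.exp (-(1 / √κ)) := by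
      have := Real.add_one_le_exp (-(1 / √κ))
      linarith
    refine (pow_le_pow_left₀ ha h1 K).trans (le_of_eq ?_)
    rw [← Real.exp_nat_mul]
    congr 1
    ring
  rcases hR0.eq_or_lt with h0 | hRpos
  · have : ‖y₀ - ys‖ = 0 := le_antisymm (h0 ▸ hR) (norm_nonneg _)
    rw [this, zero_pow two_ne_zero, mul_zero]
    positivity
  · have hpos : 0 < √(κ + 1) / τ * R := by positivity
    have hexp : Real.exp (-(K / √κ)) ≤ ((√(κ + 1) / τ * R) ^ 2)⁻¹ := by
      rw [← Real.exp_log hpos, ← Real.exp_nat_mul, ← Real.exp_neg, Real.exp_le_exp, neg_le_neg_iff,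
        le_div_iff₀ hr0]
      push_cast
      linarith
    calc (κ + 1) * (1 - 1 / √κ) ^ K * ‖y₀ - ys‖ ^ 2
        ≤ (κ + 1) * ((√(κ + 1) / τ * R) ^ 2)⁻¹ * R ^ 2 := by
          gcongr
          exact hb.trans hexp
      _ = τ ^ 2 := by
          rw [mul_pow, div_pow, Real.sq_sqrt hk1.le]
          field_simp

end AGD

variable {dx dy : ℕ}

/-! ### The joint space and the blocks of an operator on it -/

theorem norm_sq_joint (z : Joint dx dy) : ‖z‖ ^ 2 = ‖z.fst‖ ^ 2 + ‖z.snd‖ ^ 2 :=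
  WithLp.prod_norm_sq_eq_of_L2 z

theorem norm_fst_le (z : Joint dx dy) : ‖z.fst‖ ≤ ‖z‖ := by
  rw [← sq_le_sq₀ (norm_nonneg _) (norm_nonneg _), norm_sq_joint z]
  nlinarith [norm_nonneg z.snd]

theorem norm_snd_le (z : Joint dx dy) : ‖z.snd‖ ≤ ‖z‖ := by
  rw [← sq_le_sq₀ (norm_nonneg _) (norm_nonneg _), norm_sq_joint z]
  nlinarith [norm_nonneg z.fst]

theorem norm_pair_sub_sq (x x' : Euc dx) (y y' : Euc dy) :
    ‖pair x y - pair x' y'‖ ^ 2 = ‖x - x'‖ ^ 2 + ‖y - y'‖ ^ 2 :=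
  norm_sq_joint _

theorem pair_eq (x : Euc dx) (y : Euc dy) : pair x y = inclX dx dy x + inclY dx dy y := by
  apply WithLp.ofLp_injective
  simp [pair, inclX, inclY]

theorem inner_inclX (z : Joint dx dy) (u : Euc dx) :
    inner ℝ z (inclX dx dy u) = inner ℝ z.fst u := by
  simp [WithLp.prod_inner_apply, inclX]

theorem inner_inclY (z : Joint dx dy) (v : Euc dy) :
    inner ℝ z (inclY dx dy v) = inner ℝ z.snd v := by
  simp [WithLp.prod_inner_apply, inclY]

theorem inclX_inner (u : Euc dx) (z : Joint dx dy) :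
    inner ℝ (inclX dx dy u) z = inner ℝ u z.fst := by
  rw [real_inner_comm, inner_inclX, real_inner_comm]

theorem inclY_inner (v : Euc dy) (z : Joint dx dy) :
    inner ℝ (inclY dx dy v) z = inner ℝ v z.snd := by
  rw [real_inner_comm, inner_inclY, real_inner_comm]

theorem norm_projX_le : ‖projX dx dy‖ ≤ 1 :=
  ContinuousLinearMap.opNorm_le_bound _ zero_le_one fun z => by
    rw [one_mul]; exact norm_fst_le z

theorem norm_projY_le : ‖projY dx dy‖ ≤ 1 :=
  ContinuousLinearMap.opNorm_le_bound _ zero_le_one fun z => by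
    rw [one_mul]; exact norm_snd_le z

theorem norm_inclX_le : ‖inclX dx dy‖ ≤ 1 :=
  ContinuousLinearMap.opNorm_le_bound _ zero_le_one fun u => by
    rw [one_mul, ← sq_le_sq₀ (norm_nonneg _) (norm_nonneg _), norm_sq_joint]
    simp [inclX]

theorem norm_inclY_le : ‖inclY dx dy‖ ≤ 1 :=
  ContinuousLinearMap.opNorm_le_bound _ zero_le_one fun u => by
    rw [one_mul, ← sq_le_sq₀ (norm_nonneg _) (norm_nonneg _), norm_sq_joint]
    simp [inclY]

theorem norm_comp_comp_le_of_norm_le_one {E F G H : Type*}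
    [NormedAddCommGroup E] [NormedSpace ℝ E] [NormedAddCommGroup F] [NormedSpace ℝ F]
    [NormedAddCommGroup G] [NormedSpace ℝ G] [NormedAddCommGroup H] [NormedSpace ℝ H]
    {p : G →L[ℝ] H} {i : E →L[ℝ] F} (hp : ‖p‖ ≤ 1) (hi : ‖i‖ ≤ 1) (A : F →L[ℝ] G) :
    ‖p ∘L A ∘L i‖ ≤ ‖A‖ := by
  refine (p.opNorm_comp_le _).trans ?_
  have h := A.opNorm_comp_le i
  have h1 : ‖p‖ * ‖A ∘L i‖ ≤ 1 * ‖A ∘L i‖ := by gcongr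
  have h2 : ‖A‖ * ‖i‖ ≤ ‖A‖ * 1 := by gcongr
  linarith

/-! ### Nonconvex–strongly-concave functions -/

/-- The assumptions on `f` other than the boundedness of its primal function. -/
structure IsNCSC (f : Euc dx → Euc dy → ℝ) (ℓ ρ μ : ℝ) : Prop where
  dy_pos : 0 < dy
  ell_pos : 0 < ℓ
  rho_pos : 0 < ρ
  mu_pos : 0 < μ
  twice : TwiceDifferentiable f
  lipGrad : LipschitzGrad f ℓ
  lipHess : LipschitzHess f ρ
  concave : StronglyConcaveInY f μ

theorem le_mul_of_sq_le {a b c : ℝ} (hb : 0 ≤ b) (hc : 0 ≤ c) (h : a ^ 2 ≤ b ^ 2 * c ^ 2) :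
    a ≤ b * c := by
  rw [← mul_pow] at h
  exact (abs_le_of_sq_le_sq' h (by positivity)).2

namespace IsNCSC

variable {f : Euc dx → Euc dy → ℝ} {ℓ ρ μ : ℝ} (hf : IsNCSC f ℓ ρ μ)
include hf

theorem hasGradientAt (z : Joint dx dy) : HasGradientAt (joint f) (gradient (joint f) z) z :=
  (hf.twice.1 z).hasGradientAt

theorem hasFDerivAt_gradient (x : Euc dx) (y : Euc dy) :
    HasFDerivAt (gradient (joint f)) (hess f x y) (pair x y) :=
  (hf.twice.2 _).hasFDerivAt

theorem norm_grad_sub_le (x x' : Euc dx) (y y' : Euc dy) :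
    ‖grad f x y - grad f x' y'‖ ≤ ℓ * ‖pair x y - pair x' y'‖ :=
  le_mul_of_sq_le hf.ell_pos.le (norm_nonneg _) (by
    rw [norm_pair_sub_sq]; exact hf.lipGrad x x' y y')

theorem norm_hess_sub_le (x x' : Euc dx) (y y' : Euc dy) :
    ‖hess f x y - hess f x' y'‖ ≤ ρ * ‖pair x y - pair x' y'‖ :=
  le_mul_of_sq_le hf.rho_pos.le (norm_nonneg _) (by
    rw [norm_pair_sub_sq]; exact hf.lipHess x x' y y')

theorem norm_hess_le (x : Euc dx) (y : Euc dy) : ‖hess f x y‖ ≤ ℓ := by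
  have : LipschitzWith ⟨ℓ, hf.ell_pos.le⟩ (gradient (joint f)) :=
    LipschitzWith.of_dist_le_mul fun z z' => by
      rw [dist_eq_norm, dist_eq_norm]
      exact hf.norm_grad_sub_le z.fst z'.fst z.snd z'.snd
  exact norm_fderiv_le_of_lipschitz ℝ this

theorem hess_symm (x : Euc dx) (y : Euc dy) (u v : Joint dx dy) :
    inner ℝ (hess f x y u) v = inner ℝ u (hess f x y v) := by
  set B : Joint dx dy →L[ℝ] Joint dx dy →L[ℝ] ℝ :=
    (isBoundedBilinearMap_inner (𝕜 := ℝ) (E := Joint dx dy)).toContinuousLinearMap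
  have h1 : HasFDerivAt (fun z => B (gradient (joint f) z)) (B ∘L hess f x y) (pair x y) :=
    B.hasFDerivAt.comp _ (hf.hasFDerivAt_gradient x y)
  have h2 := second_derivative_symmetric (𝕜 := ℝ)
    (fun z => (hf.hasGradientAt z).hasFDerivAt.congr_fderiv
      (show _ = B (gradient (joint f) z) from by ext; rfl)) h1 u v
  have h3 : inner ℝ (hess f x y u) v = inner ℝ (hess f x y v) u := h2
  rw [h3, real_inner_comm]

theorem norm_hessXY_le (x : Euc dx) (y : Euc dy) : ‖hessXY f x y‖ ≤ ℓ :=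
  (norm_comp_comp_le_of_norm_le_one norm_projX_le norm_inclY_le _).trans (hf.norm_hess_le x y)

theorem norm_hessYX_le (x : Euc dx) (y : Euc dy) : ‖hessYX f x y‖ ≤ ℓ :=
  (norm_comp_comp_le_of_norm_le_one norm_projY_le norm_inclX_le _).trans (hf.norm_hess_le x y)

theorem norm_hessXX_le (x : Euc dx) (y : Euc dy) : ‖hessXX f x y‖ ≤ ℓ :=
  (norm_comp_comp_le_of_norm_le_one norm_projX_le norm_inclX_le _).trans (hf.norm_hess_le x y)

theorem hessXX_symm (x : Euc dx) (y : Euc dy) (u v : Euc dx) :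
    inner ℝ (hessXX f x y u) v = inner ℝ u (hessXX f x y v) := by
  have h := hf.hess_symm x y (inclX dx dy u) (inclX dx dy v)
  rwa [inner_inclX, inclX_inner] at h

theorem hessYY_symm (x : Euc dx) (y : Euc dy) (u v : Euc dy) :
    inner ℝ (hessYY f x y u) v = inner ℝ u (hessYY f x y v) := by
  have h := hf.hess_symm x y (inclY dx dy u) (inclY dx dy v)
  rwa [inner_inclY, inclY_inner] at h

theorem hessXY_adjoint (x : Euc dx) (y : Euc dy) (u : Euc dx) (v : Euc dy) :
    inner ℝ u (hessXY f x y v) = inner ℝ (hessYX f x y u) v := by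
  have h := hf.hess_symm x y (inclX dx dy u) (inclY dx dy v)
  rw [inner_inclY, inclX_inner] at h
  exact h.symm

/-! ### The partial gradient in `y` -/

theorem hasGradientAt_right (x : Euc dx) (y : Euc dy) :
    HasGradientAt (f x) (gradY f x y) y := by
  have h1 : HasFDerivAt (fun v => inclX dx dy x + inclY dx dy v) (inclY dx dy) y :=
    (inclY dx dy).hasFDerivAt.const_add _
  have h2 := (hf.hasGradientAt (inclX dx dy x + inclY dx dy y)).hasFDerivAt.comp y h1
  rw [hasGradientAt_iff_hasFDerivAt]
  have h3 : joint f ∘ (fun v => inclX dx dy x + inclY dx dy v) = f x := by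
    funext v
    simp [← pair_eq, joint, pair]
  rw [h3] at h2
  refine h2.congr_fderiv ?_
  ext v
  simp only [ContinuousLinearMap.comp_apply, InnerProductSpace.toDual_apply_apply, inner_inclY,
    ← pair_eq]
  rfl

theorem norm_gradX_sub_le (x : Euc dx) (y y' : Euc dy) :
    ‖gradX f x y - gradX f x y'‖ ≤ ℓ * ‖y - y'‖ := by
  refine (norm_fst_le (grad f x y - grad f x y')).trans ?_
  refine le_mul_of_sq_le hf.ell_pos.le (norm_nonneg _) ?_
  simpa using hf.lipGrad x x y y'

theorem norm_gradY_sub_le (x : Euc dx) (y y' : Euc dy) :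
    ‖gradY f x y - gradY f x y'‖ ≤ ℓ * ‖y - y'‖ := by
  refine (norm_snd_le (grad f x y - grad f x y')).trans ?_
  refine le_mul_of_sq_le hf.ell_pos.le (norm_nonneg _) ?_
  simpa using hf.lipGrad x x y y'

theorem norm_gradY_sub_le' (x x' : Euc dx) (y : Euc dy) :
    ‖gradY f x y - gradY f x' y‖ ≤ ℓ * ‖x - x'‖ := by
  refine (norm_snd_le (grad f x y - grad f x' y)).trans ?_
  refine le_mul_of_sq_le hf.ell_pos.le (norm_nonneg _) ?_
  simpa using hf.lipGrad x x' y y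

theorem inner_gradY_sub_le (x : Euc dx) (y y' : Euc dy) :
    inner ℝ (gradY f x y - gradY f x y') (y - y') ≤ -μ * ‖y - y'‖ ^ 2 := by
  have h1 := hf.concave x y y'
  have h2 := hf.concave x y' y
  rw [← neg_sub y y', inner_neg_right, norm_neg] at h2
  rw [inner_sub_left]
  linarith

/-- This needs `dy ≠ 0`, so that there are two different points `y`. -/
theorem mu_le_ell : μ ≤ ℓ := by
  have h1 := hf.inner_gradY_sub_le 0 (EuclideanSpace.single ⟨0, hf.dy_pos⟩ 1) 0
  have h2 := hf.norm_gradY_sub_le 0 (EuclideanSpace.single ⟨0, hf.dy_pos⟩ 1) 0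
  have h3 := (abs_le.1 (abs_real_inner_le_norm
    (gradY f 0 (EuclideanSpace.single ⟨0, hf.dy_pos⟩ 1) - gradY f 0 0)
    (EuclideanSpace.single ⟨0, hf.dy_pos⟩ (1 : ℝ) - 0))).1
  simp only [sub_zero, PiLp.norm_single, norm_one, mul_one, one_pow] at h1 h2 h3
  linarith

theorem one_le_kappa : 1 ≤ ℓ / μ := by
  rw [one_le_div hf.mu_pos]; exact hf.mu_le_ell

/-! ### Inverting `∇²_yy f` -/

theorem hasFDerivAt_gradY (x : Euc dx) (y : Euc dy) :
    HasFDerivAt (gradY f x) (hessYY f x y) y := by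
  have h1 : HasFDerivAt (fun v => inclX dx dy x + inclY dx dy v) (inclY dx dy) y :=
    (inclY dx dy).hasFDerivAt.const_add _
  have h2 := hf.hasFDerivAt_gradient x y
  rw [pair_eq] at h2
  have h3 := (projY dx dy).hasFDerivAt.comp y (h2.comp y h1)
  refine h3.congr_of_eventuallyEq (Eventually.of_forall fun v => ?_)
  simp only [Function.comp_apply, ← pair_eq]
  rfl

theorem inner_hessYY_le (x : Euc dx) (y v : Euc dy) :
    inner ℝ (hessYY f x y v) v ≤ -μ * ‖v‖ ^ 2 := by
  have h0 : HasFDerivAt (gradY f x) (hessYY f x y) (y + (0 : ℝ) • v) := by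
    simpa using hf.hasFDerivAt_gradY x y
  have h1 := h0.comp_hasDerivAt (0 : ℝ) (hasDerivAt_line y v 0)
  have h3 := (h1.inner ℝ (hasDerivAt_const (0 : ℝ) v)).tendsto_slope_zero_right
  simp only [inner_zero_right, zero_add] at h3
  refine le_of_tendsto h3 ?_
  filter_upwards [self_mem_nhdsWithin] with t ht
  have ht : 0 < t := ht
  have h4 := hf.inner_gradY_sub_le x (y + t • v) y
  rw [add_sub_cancel_left, inner_smul_right, norm_smul, Real.norm_of_nonneg ht.le,
    inner_sub_left] at h4
  rw [smul_eq_mul, inv_mul_le_iff₀ ht]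
  refine le_of_mul_le_mul_left ?_ ht
  simp only [Function.comp_apply, zero_smul, add_zero]
  linarith

theorem hessYY_isInvertible (x : Euc dx) (y : Euc dy) : (hessYY f x y).IsInvertible := by
  have hinj : Function.Injective (hessYY f x y : Euc dy →ₗ[ℝ] Euc dy) := by
    rw [injective_iff_map_eq_zero]
    intro v hv
    have h := hf.inner_hessYY_le x y v
    have hv' : hessYY f x y v = 0 := hv
    rw [hv', inner_zero_left] at h
    have : ‖v‖ ^ 2 ≤ 0 := by nlinarith [hf.mu_pos]
    exact norm_eq_zero.1 (pow_eq_zero_iff two_ne_zero |>.1 (le_antisymm this (by positivity)))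
  refine ⟨(LinearEquiv.ofInjectiveEndo _ hinj).toContinuousLinearEquiv, ?_⟩
  ext v
  rfl

theorem norm_inverse_hessYY_le (x : Euc dx) (y : Euc dy) :
    ‖(hessYY f x y).inverse‖ ≤ 1 / μ := by
  refine ContinuousLinearMap.opNorm_le_bound _ (one_div_nonneg.2 hf.mu_pos.le) fun w => ?_
  have h := hf.inner_hessYY_le x y ((hessYY f x y).inverse w)
  rw [(hf.hessYY_isInvertible x y).self_apply_inverse] at h
  have h2 := (abs_le.1 (abs_real_inner_le_norm w ((hessYY f x y).inverse w))).1
  rw [one_div_mul_eq_div, le_div_iff₀ hf.mu_pos]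
  rcases (norm_nonneg ((hessYY f x y).inverse w)).eq_or_lt with h0 | h0
  · rw [← h0, zero_mul]; positivity
  · refine le_of_mul_le_mul_right ?_ h0
    linarith

/-! ### The Schur complement -/

theorem inner_inverse_hessYY_le (x : Euc dx) (y w : Euc dy) :
    inner ℝ w ((hessYY f x y).inverse w) ≤ 0 := by
  have h := hf.inner_hessYY_le x y ((hessYY f x y).inverse w)
  rw [(hf.hessYY_isInvertible x y).self_apply_inverse] at h
  have := hf.mu_pos
  have : 0 ≤ μ * ‖(hessYY f x y).inverse w‖ ^ 2 := by positivity
  linarith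

theorem inverse_hessYY_symm (x : Euc dx) (y u v : Euc dy) :
    inner ℝ ((hessYY f x y).inverse u) v = inner ℝ u ((hessYY f x y).inverse v) := by
  have h := hf.hessYY_symm x y ((hessYY f x y).inverse u) ((hessYY f x y).inverse v)
  rw [(hf.hessYY_isInvertible x y).self_apply_inverse,
    (hf.hessYY_isInvertible x y).self_apply_inverse] at h
  exact h.symm

theorem schur_symm (x : Euc dx) (y : Euc dy) (u v : Euc dx) :
    inner ℝ (schur f x y u) v = inner ℝ u (schur f x y v) := by
  simp only [schur, _root_.sub_apply, ContinuousLinearMap.comp_apply, inner_sub_left,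
    inner_sub_right, hf.hessXX_symm, hf.hessXY_adjoint]
  rw [real_inner_comm v (hessXY _ _ _ _), hf.hessXY_adjoint, ← hf.inverse_hessYY_symm,
    real_inner_comm (hessYX f x y u)]

/-- The Schur complement is bounded below by `∇²_xx f`, as `∇²_yy f` is negative definite. -/
theorem neg_ell_le_inner_schur (x : Euc dx) (y : Euc dy) (u : Euc dx) :
    -ℓ * ‖u‖ ^ 2 ≤ inner ℝ u (schur f x y u) := by
  simp only [schur, _root_.sub_apply, ContinuousLinearMap.comp_apply, inner_sub_right,
    hf.hessXY_adjoint]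
  have h1 := hf.inner_inverse_hessYY_le x y (hessYX f x y u)
  have h2 := (abs_le.1 (abs_real_inner_le_norm u (hessXX f x y u))).1
  have h3 := (hessXX f x y).le_of_opNorm_le (hf.norm_hessXX_le x y) u
  nlinarith [norm_nonneg u]

theorem norm_schur_le (x : Euc dx) (y : Euc dy) : ‖schur f x y‖ ≤ (1 + ℓ / μ) * ℓ := by
  have hμ := hf.mu_pos
  have hℓ := hf.ell_pos
  refine (norm_sub_le _ _).trans ?_
  have h1 := hf.norm_hessXX_le x y
  have h2 : ‖hessXY f x y ∘L (hessYY f x y).inverse ∘L hessYX f x y‖ ≤ ℓ * (1 / μ * ℓ) := by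
    refine (ContinuousLinearMap.opNorm_comp_le _ _).trans ?_
    gcongr
    · exact hf.norm_hessXY_le x y
    · refine (ContinuousLinearMap.opNorm_comp_le _ _).trans ?_
      gcongr
      · exact hf.norm_inverse_hessYY_le x y
      · exact hf.norm_hessYX_le x y
  calc _ ≤ ℓ + ℓ * (1 / μ * ℓ) := add_le_add h1 h2
    _ = _ := by ring

theorem norm_schur_sub_le (x x' : Euc dx) (y y' : Euc dy) :
    ‖schur f x y - schur f x' y'‖ ≤ (1 + ℓ / μ) ^ 2 * ρ * ‖pair x y - pair x' y'‖ := by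
  have hμ := hf.mu_pos
  have hℓ := hf.ell_pos
  have hH := hf.norm_hess_sub_le x x' y y'
  set δ := ρ * ‖pair x y - pair x' y'‖ with hδ
  have hδ0 : 0 ≤ δ := by have := hf.rho_pos; positivity
  have hXX : ‖hessXX f x y - hessXX f x' y'‖ ≤ δ := by
    refine le_trans ?_ hH
    have := norm_comp_comp_le_of_norm_le_one (norm_projX_le (dx := dx) (dy := dy))
      (norm_inclX_le (dx := dx) (dy := dy)) (hess f x y - hess f x' y')
    rwa [ContinuousLinearMap.sub_comp, ContinuousLinearMap.comp_sub] at this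
  have hXY : ‖hessXY f x y - hessXY f x' y'‖ ≤ δ := by
    refine le_trans ?_ hH
    have := norm_comp_comp_le_of_norm_le_one (norm_projX_le (dx := dx) (dy := dy))
      (norm_inclY_le (dx := dx) (dy := dy)) (hess f x y - hess f x' y')
    rwa [ContinuousLinearMap.sub_comp, ContinuousLinearMap.comp_sub] at this
  have hYX : ‖hessYX f x y - hessYX f x' y'‖ ≤ δ := by
    refine le_trans ?_ hH
    have := norm_comp_comp_le_of_norm_le_one (norm_projY_le (dx := dx) (dy := dy))
      (norm_inclX_le (dx := dx) (dy := dy)) (hess f x y - hess f x' y')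
    rwa [ContinuousLinearMap.sub_comp, ContinuousLinearMap.comp_sub] at this
  have hYY : ‖hessYY f x' y' - hessYY f x y‖ ≤ δ := by
    rw [norm_sub_rev]
    refine le_trans ?_ hH
    have := norm_comp_comp_le_of_norm_le_one (norm_projY_le (dx := dx) (dy := dy))
      (norm_inclY_le (dx := dx) (dy := dy)) (hess f x y - hess f x' y')
    rwa [ContinuousLinearMap.sub_comp, ContinuousLinearMap.comp_sub] at this
  have b1 := hf.norm_inverse_hessYY_le x y
  have b2 := hf.norm_inverse_hessYY_le x' y'
  have hinv : ‖(hessYY f x y).inverse - (hessYY f x' y').inverse‖ ≤ 1 / μ * (δ * (1 / μ)) := by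
    have e : (hessYY f x y).inverse - (hessYY f x' y').inverse =
        (hessYY f x y).inverse ∘L (hessYY f x' y' - hessYY f x y) ∘L (hessYY f x' y').inverse := by
      ext1 v
      simp [(hf.hessYY_isInvertible x y).inverse_apply_self,
        (hf.hessYY_isInvertible x' y').self_apply_inverse]
    rw [e]
    refine (ContinuousLinearMap.opNorm_comp_le _ _).trans ?_
    gcongr
    refine (ContinuousLinearMap.opNorm_comp_le _ _).trans ?_
    gcongr
  have e : schur f x y - schur f x' y' = (hessXX f x y - hessXX f x' y') -
      ((hessXY f x y - hessXY f x' y') ∘L (hessYY f x y).inverse ∘L hessYX f x y +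
       hessXY f x' y' ∘L ((hessYY f x y).inverse - (hessYY f x' y').inverse) ∘L hessYX f x y +
       hessXY f x' y' ∘L (hessYY f x' y').inverse ∘L (hessYX f x y - hessYX f x' y')) := by
    ext1 v
    simp only [schur, _root_.sub_apply, _root_.add_apply, ContinuousLinearMap.comp_apply, map_sub]
    abel
  have c1 : ‖(hessXY f x y - hessXY f x' y') ∘L (hessYY f x y).inverse ∘L hessYX f x y‖ ≤
      δ * (1 / μ * ℓ) := by
    refine (ContinuousLinearMap.opNorm_comp_le _ _).trans ?_
    gcongr
    refine (ContinuousLinearMap.opNorm_comp_le _ _).trans ?_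
    gcongr
    exact hf.norm_hessYX_le x y
  have c2 : ‖hessXY f x' y' ∘L ((hessYY f x y).inverse - (hessYY f x' y').inverse) ∘L
      hessYX f x y‖ ≤ ℓ * (1 / μ * (δ * (1 / μ)) * ℓ) := by
    refine (ContinuousLinearMap.opNorm_comp_le _ _).trans ?_
    gcongr
    · exact hf.norm_hessXY_le x' y'
    refine (ContinuousLinearMap.opNorm_comp_le _ _).trans ?_
    gcongr
    exact hf.norm_hessYX_le x y
  have c3 : ‖hessXY f x' y' ∘L (hessYY f x' y').inverse ∘L (hessYX f x y - hessYX f x' y')‖ ≤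
      ℓ * (1 / μ * δ) := by
    refine (ContinuousLinearMap.opNorm_comp_le _ _).trans ?_
    gcongr
    · exact hf.norm_hessXY_le x' y'
    refine (ContinuousLinearMap.opNorm_comp_le _ _).trans ?_
    gcongr
  rw [e]
  have t1 := norm_sub_le (hessXX f x y - hessXX f x' y')
    ((hessXY f x y - hessXY f x' y') ∘L (hessYY f x y).inverse ∘L hessYX f x y +
       hessXY f x' y' ∘L ((hessYY f x y).inverse - (hessYY f x' y').inverse) ∘L hessYX f x y +
       hessXY f x' y' ∘L (hessYY f x' y').inverse ∘L (hessYX f x y - hessYX f x' y'))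
  have t2 := norm_add₃_le
    (a := (hessXY f x y - hessXY f x' y') ∘L (hessYY f x y).inverse ∘L hessYX f x y)
    (b := hessXY f x' y' ∘L ((hessYY f x y).inverse - (hessYY f x' y').inverse) ∘L hessYX f x y)
    (c := hessXY f x' y' ∘L (hessYY f x' y').inverse ∘L (hessYX f x y - hessYX f x' y'))
  have e2 : (1 + ℓ / μ) ^ 2 * ρ * ‖pair x y - pair x' y'‖ =
      δ + (δ * (1 / μ * ℓ) + ℓ * (1 / μ * (δ * (1 / μ)) * ℓ) + ℓ * (1 / μ * δ)) := by
    rw [hδ]; ring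
  rw [e2]
  linarith

/-! ### The maximizer and the primal function -/

theorem exists_argmax (x : Euc dx) : ∃ y, ∀ y', f x y' ≤ f x y := by
  have hcont : Continuous (f x) :=
    continuous_iff_continuousAt.2 fun y =>
      (hf.hasGradientAt_right x y).differentiableAt.continuousAt
  refine hcont.exists_forall_ge (β := Euc dy) ?_
  have hbound : ∀ y, f x y ≤ f x 0 + (‖gradY f x 0‖ - μ / 2 * ‖y‖) * ‖y‖ := fun y => by
    have h := hf.concave x y 0
    have h2 := real_inner_le_norm (gradY f x 0) y
    rw [sub_zero] at h
    linarith
  refine tendsto_atBot_mono hbound (tendsto_atBot_add_const_left _ _ ?_)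
  have hn := tendsto_norm_cocompact_atTop (E := Euc dy)
  refine Tendsto.atBot_mul_atTop₀ ?_ hn
  simp_rw [sub_eq_add_neg]
  refine tendsto_atBot_add_const_left _ _ (tendsto_neg_atTop_atBot.comp ?_)
  exact hn.const_mul_atTop (half_pos hf.mu_pos)

theorem le_argmaxY (x : Euc dx) (y : Euc dy) : f x y ≤ f x (argmaxY f x) :=
  Classical.epsilon_spec (hf.exists_argmax x) y

theorem primal_eq (x : Euc dx) : primal f x = f x (argmaxY f x) :=
  le_antisymm (ciSup_le (hf.le_argmaxY x))
    (le_ciSup ⟨_, Set.forall_mem_range.2 (hf.le_argmaxY x)⟩ _)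

theorem gradY_argmaxY (x : Euc dx) : gradY f x (argmaxY f x) = 0 := by
  have h : IsLocalMax (f x) (argmaxY f x) := Eventually.of_forall (hf.le_argmaxY x)
  have := h.hasFDerivAt_eq_zero (hf.hasGradientAt_right x _).hasFDerivAt
  exact (InnerProductSpace.toDual ℝ (Euc dy)).map_eq_zero_iff.1 this

theorem norm_argmaxY_sub_le (x x' : Euc dx) :
    ‖argmaxY f x - argmaxY f x'‖ ≤ ℓ / μ * ‖x - x'‖ := by
  have h1 := hf.inner_gradY_sub_le x' (argmaxY f x) (argmaxY f x')
  rw [hf.gradY_argmaxY, sub_zero] at h1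
  have h2 := hf.norm_gradY_sub_le' x' x (argmaxY f x)
  rw [hf.gradY_argmaxY, sub_zero, norm_sub_rev x'] at h2
  have h3 := (abs_le.1 (abs_real_inner_le_norm (gradY f x' (argmaxY f x))
    (argmaxY f x - argmaxY f x'))).1
  rw [div_mul_eq_mul_div, le_div_iff₀ hf.mu_pos]
  rcases (norm_nonneg (argmaxY f x - argmaxY f x')).eq_or_lt with h0 | h0
  · rw [← h0, zero_mul]
    have := hf.ell_pos
    positivity
  · refine le_of_mul_le_mul_right ?_ h0
    nlinarith

theorem norm_pair_argmaxY_sub_le (x x' : Euc dx) :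
    ‖pair x (argmaxY f x) - pair x' (argmaxY f x')‖ ≤ √2 * (ℓ / μ) * ‖x - x'‖ := by
  have hκ := hf.one_le_kappa
  refine le_mul_of_sq_le (by positivity) (norm_nonneg _) ?_
  have h := hf.norm_argmaxY_sub_le x x'
  rw [norm_pair_sub_sq, mul_pow, Real.sq_sqrt zero_le_two]
  have h2 := pow_le_pow_left₀ (norm_nonneg _) h 2
  have h3 : 1 ≤ (ℓ / μ) ^ 2 := one_le_pow₀ hκ
  rw [mul_pow] at h2
  nlinarith [sq_nonneg ‖x - x'‖]

/-- The implicit function theorem for `∇_y f (x, y) = 0`. As `y*` is already known to be Lipschitz,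
it needs no more than the differentiability of `∇ f` at `(x, y*(x))`. -/
theorem hasFDerivAt_argmaxY (x : Euc dx) :
    HasFDerivAt (argmaxY f)
      (-((hessYY f x (argmaxY f x)).inverse ∘L hessYX f x (argmaxY f x))) x := by
  have hbig : (fun x' => pair x' (argmaxY f x') - pair x (argmaxY f x)) =O[𝓝 x]
      fun x' => x' - x :=
    Asymptotics.IsBigO.of_bound _ (Eventually.of_forall fun x' => hf.norm_pair_argmaxY_sub_le x' x)
  have hlim : Tendsto (fun x' => pair x' (argmaxY f x')) (𝓝 x) (𝓝 (pair x (argmaxY f x))) := by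
    rw [← tendsto_sub_nhds_zero_iff]
    refine hbig.trans_tendsto ?_
    rw [tendsto_sub_nhds_zero_iff]
    exact tendsto_id
  have h1 := ((hf.hasFDerivAt_gradient x (argmaxY f x)).isLittleO.comp_tendsto hlim).trans_isBigO
    hbig
  -- Solve the linearization of `∇_y f (x', y*(x')) = 0` for `y*(x') - y*(x)`.
  have h2 := (((hessYY f x (argmaxY f x)).inverse ∘L projY dx dy).isBigO_comp _ _).trans_isLittleO
    h1
  rw [hasFDerivAt_iff_isLittleO]
  refine h2.neg_left.congr_left fun x' => ?_
  have e1 : pair x' (argmaxY f x') - pair x (argmaxY f x) =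
      inclX dx dy (x' - x) + inclY dx dy (argmaxY f x' - argmaxY f x) := by
    rw [pair_eq, pair_eq, map_sub, map_sub]; abel
  have e2 : ∀ z, projY dx dy (gradient (joint f) (pair z (argmaxY f z))) = 0 := hf.gradY_argmaxY
  have e3 : projY dx dy (hess f x (argmaxY f x) (inclX dx dy (x' - x))) =
    hessYX f x (argmaxY f x) (x' - x) := rfl
  have e4 : projY dx dy (hess f x (argmaxY f x) (inclY dx dy (argmaxY f x' - argmaxY f x))) =
    hessYY f x (argmaxY f x) (argmaxY f x' - argmaxY f x) := rfl
  simp only [Function.comp_apply, ContinuousLinearMap.comp_apply, e1, map_sub (projY dx dy),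
    map_add, e2, e3, e4, map_sub (ContinuousLinearMap.inverse _), map_zero,
    (hf.hessYY_isInvertible x (argmaxY f x)).inverse_apply_self, _root_.neg_apply,
    map_sub (hessYX f x (argmaxY f x))]
  abel

theorem hasFDerivAt_pair_argmaxY (x : Euc dx) :
    HasFDerivAt (fun x' => pair x' (argmaxY f x'))
      (inclX dx dy + inclY dx dy ∘L
        (-((hessYY f x (argmaxY f x)).inverse ∘L hessYX f x (argmaxY f x)))) x := by
  simp_rw [pair_eq]
  exact (inclX dx dy).hasFDerivAt.add
    ((inclY dx dy).hasFDerivAt.comp x (hf.hasFDerivAt_argmaxY x))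

/-- The term with the derivative of `y*` vanishes, since `∇_y f (x, y*(x)) = 0`. -/
theorem hasGradientAt_primal (x : Euc dx) :
    HasGradientAt (primal f) (gradX f x (argmaxY f x)) x := by
  have h := (hf.hasGradientAt (pair x (argmaxY f x))).hasFDerivAt.comp x
    (hf.hasFDerivAt_pair_argmaxY x)
  have e : joint f ∘ (fun x' => pair x' (argmaxY f x')) = primal f :=
    funext fun x' => (hf.primal_eq x').symm
  rw [e] at h
  rw [hasGradientAt_iff_hasFDerivAt]
  refine h.congr_fderiv ?_
  ext v
  have h0 : (gradient (joint f) (pair x (argmaxY f x))).snd = 0 := hf.gradY_argmaxY x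
  simp only [ContinuousLinearMap.comp_apply, InnerProductSpace.toDual_apply_apply,
    _root_.add_apply, inner_add_right, inner_inclX, inner_inclY, h0, inner_zero_left, add_zero]
  rfl

/-- The Hessian of the primal function is the Schur complement at `(x, y*(x))`. -/
theorem hasFDerivAt_gradX_argmaxY (x : Euc dx) :
    HasFDerivAt (fun x' => gradX f x' (argmaxY f x')) (schur f x (argmaxY f x)) x := by
  have h := (projX dx dy).hasFDerivAt.comp x
    ((hf.hasFDerivAt_gradient x (argmaxY f x)).comp x (hf.hasFDerivAt_pair_argmaxY x))
  refine h.congr_fderiv ?_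
  ext1 v
  simp only [schur, hessXX, hessXY, ContinuousLinearMap.comp_apply, _root_.add_apply,
    _root_.neg_apply, map_add, map_neg, sub_eq_add_neg]

end IsNCSC

/-! ### Eigenvalues and tolerances -/

theorem inner_clm_le {d : ℕ} {A : Euc d →L[ℝ] Euc d} {c : ℝ} (h : ‖A‖ ≤ c) (v : Euc d) :
    |inner ℝ v (A v)| ≤ c * ‖v‖ ^ 2 := by
  refine (abs_real_inner_le_norm _ _).trans ?_
  have := A.le_of_opNorm_le h v
  nlinarith [norm_nonneg v]

/-- A lower bound on the quadratic form is a lower bound on the smallest eigenvalue, also in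
dimension `0` if the bound is nonpositive. -/
theorem le_lambdaMin {d : ℕ} {H : Euc d →L[ℝ] Euc d} {c : ℝ} (hc : c ≤ 0)
    (h : ∀ v, c * ‖v‖ ^ 2 ≤ inner ℝ v (H v)) : c ≤ lambdaMin H := by
  refine Real.le_sInf (fun lam hlam => ?_) hc
  obtain ⟨v, hv⟩ := Module.End.HasEigenvalue.exists_hasEigenvector hlam
  have h1 := h v
  have h2 : H v = lam • v := hv.apply_eq_smul
  rw [h2, inner_smul_right, real_inner_self_eq_norm_sq] at h1
  have : 0 < ‖v‖ := norm_pos_iff.2 hv.2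
  exact le_of_mul_le_mul_right h1 (by positivity)

theorem innerTol_pos {ℓ ρ M ε : ℝ} (hℓ : 0 < ℓ) (hρ : 0 < ρ) (hM : 0 < M) (hε : 0 < ε) :
    0 < innerTol ℓ ρ M ε := by
  rw [innerTol]
  exact lt_min (by positivity) (by positivity)

theorem innerTol_mono {ℓ ρ M ε ε' : ℝ} (hℓ : 0 < ℓ) (hρ : 0 < ρ) (hM : 0 < M) (h : ε' ≤ ε) :
    innerTol ℓ ρ M ε' ≤ innerTol ℓ ρ M ε := by
  rw [innerTol, innerTol]
  gcongr

theorem mul_innerTol_le {ℓ ρ M ε : ℝ} (hℓ : 0 < ℓ) : ℓ * innerTol ℓ ρ M ε ≤ ε / 192 := by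
  have h : innerTol ℓ ρ M ε ≤ 1 / 192 * ε / ℓ := min_le_left _ _
  rw [le_div_iff₀ hℓ] at h
  linarith

namespace IsNCSC

variable {f : Euc dx → Euc dy → ℝ} {ℓ ρ μ κ M : ℝ} (hf : IsNCSC f ℓ ρ μ) (hκ : κ = ℓ / μ)
  (hM : M = 4 * √2 * κ ^ 3 * ρ)
include hf

theorem norm_gradX_sub_argmaxY_le {x : Euc dx} {y : Euc dy} {ε : ℝ}
    (hy : ‖y - argmaxY f x‖ ≤ innerTol ℓ ρ M ε) :
    ‖gradX f x y - gradX f x (argmaxY f x)‖ ≤ ε / 192 :=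
  (hf.norm_gradX_sub_le x y _).trans
    ((mul_le_mul_of_nonneg_left hy hf.ell_pos.le).trans (mul_innerTol_le hf.ell_pos))

include hκ

/-! ### Accuracy of AGD and smoothness of the primal function -/

/-- `2 √κ log (√(κ + 1) R / τ)` steps of AGD find `y*(x)` up to `τ` from a distance of at
most `R`. -/
theorem norm_agdMax_sub_le (x : Euc dx) {y₀ : Euc dy} {K : ℕ} {R τ : ℝ} (hτ : 0 < τ)
    (hR : ‖y₀ - argmaxY f x‖ ≤ R) (hK : 2 * √κ * Real.log (√(κ + 1) / τ * R) ≤ K) :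
    ‖agdMax f ℓ κ x y₀ K - argmaxY f x‖ ≤ τ := by
  have hgrad : ∀ y, HasGradientAt (fun y => -f x y) (-gradY f x y) y := fun y => by
    rw [hasGradientAt_iff_hasFDerivAt, map_neg]
    exact (hf.hasGradientAt_right x y).hasFDerivAt.neg
  refine agd_dist_le (h := fun y => -f x y) (μ := μ) (hκ ▸ hf.one_le_kappa) hf.mu_pos
    (by rw [hκ, div_mul_cancel₀ _ hf.mu_pos.ne']) (fun y y' => ?_) (fun y v => ?_) ?_ hτ hR hK
  · rw [(hgrad y').gradient, inner_neg_left]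
    linarith [hf.concave x y y']
  · rw [(hgrad y).gradient]
    refine le_add_of_lipschitz_gradient hgrad (fun y y' => ?_) y v
    rw [neg_sub_neg, norm_sub_rev]
    exact hf.norm_gradY_sub_le x y y'
  · rw [(hgrad _).gradient, hf.gradY_argmaxY, neg_zero]

theorem kappa_ge : 1 ≤ κ := hκ ▸ hf.one_le_kappa

theorem norm_schur_le' (x : Euc dx) (y : Euc dy) : ‖schur f x y‖ ≤ 2 * κ * ℓ := by
  refine (hf.norm_schur_le x y).trans ?_
  rw [← hκ]
  nlinarith [hf.kappa_ge hκ, hf.ell_pos]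

theorem norm_schur_sub_argmaxY_le (x : Euc dx) (y : Euc dy) :
    ‖schur f x y - schur f x (argmaxY f x)‖ ≤ 4 * κ ^ 2 * ρ * ‖y - argmaxY f x‖ := by
  have h := hf.norm_schur_sub_le x x y (argmaxY f x)
  have e : ‖pair x y - pair x (argmaxY f x)‖ = ‖y - argmaxY f x‖ := by
    rw [← sq_eq_sq₀ (norm_nonneg _) (norm_nonneg _), norm_pair_sub_sq]
    simp
  rw [e, ← hκ] at h
  refine h.trans ?_
  have := hf.kappa_ge hκ
  have := hf.rho_pos
  gcongr
  nlinarith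

include hM

theorem M_pos : 0 < M := by
  have := hf.kappa_ge hκ
  have := hf.rho_pos
  rw [hM]; positivity

theorem le_M : 28 / 5 * κ ^ 3 * ρ ≤ M := by
  have := hf.kappa_ge hκ
  have := hf.rho_pos
  have h2 : 7 / 5 ≤ √2 := Real.le_sqrt_of_sq_le (by norm_num)
  have h3 : 0 ≤ κ ^ 3 * ρ := by positivity
  rw [hM]
  nlinarith

theorem norm_hess_primal_sub_le (x x' : Euc dx) :
    ‖schur f x (argmaxY f x) - schur f x' (argmaxY f x')‖ ≤ M * ‖x - x'‖ := by
  have h := hf.norm_schur_sub_le x x' (argmaxY f x) (argmaxY f x')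
  have h2 := hf.norm_pair_argmaxY_sub_le x x'
  have hk := hf.kappa_ge hκ
  have hρ := hf.rho_pos
  rw [← hκ] at h h2
  calc _ ≤ (1 + κ) ^ 2 * ρ * (√2 * κ * ‖x - x'‖) := h.trans (by gcongr)
    _ ≤ (4 * κ ^ 2) * ρ * (√2 * κ * ‖x - x'‖) := by
      gcongr
      nlinarith
    _ = M * ‖x - x'‖ := by rw [hM]; ring

theorem primal_add_le (x s : Euc dx) :
    primal f (x + s) ≤ primal f x + inner ℝ (gradX f x (argmaxY f x)) s +
      1 / 2 * inner ℝ s (schur f x (argmaxY f x) s) + M / 6 * ‖s‖ ^ 3 :=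
  taylor_two_le hf.hasGradientAt_primal hf.hasFDerivAt_gradX_argmaxY
    (hf.norm_hess_primal_sub_le hκ hM) x s

theorem norm_grad_primal_add_sub_le (x s : Euc dx) :
    ‖gradX f (x + s) (argmaxY f (x + s)) - gradX f x (argmaxY f x) -
      schur f x (argmaxY f x) s‖ ≤ M / 2 * ‖s‖ ^ 2 :=
  norm_taylor_one_le hf.hasFDerivAt_gradX_argmaxY (hf.norm_hess_primal_sub_le hκ hM) x s

/-! ### One step of the inexact cubic Newton method -/

section Step

variable {x s : Euc dx} {y : Euc dy} {ε : ℝ}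
  (hy : ‖y - argmaxY f x‖ ≤ innerTol ℓ ρ M ε)
  (hs : ∀ v, cubicModel (gradX f x y) (schur f x y) M s ≤
    cubicModel (gradX f x y) (schur f x y) M v)
include hy

/-- The geometric mean of `‖S(x, y) - ∇²P(x)‖ ≤ 4 κ² ρ ‖y - y*(x)‖` and
`‖S(x, y) - ∇²P(x)‖ ≤ 4 κ ℓ`. Either bound alone is too weak for some values of `ε`. -/
theorem norm_schur_sub_le_sqrt :
    ‖schur f x y - schur f x (argmaxY f x)‖ ≤ √(M * ε) / 8 := by
  have hk := hf.kappa_ge hκ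
  have hρ := hf.rho_pos
  have hℓ := hf.ell_pos
  have h1 := (hf.norm_schur_sub_argmaxY_le hκ x y).trans
    (mul_le_mul_of_nonneg_left hy (by positivity))
  have h2 : ‖schur f x y - schur f x (argmaxY f x)‖ ≤ 4 * κ * ℓ := by
    refine (norm_sub_le _ _).trans ?_
    linarith [hf.norm_schur_le' hκ x y, hf.norm_schur_le' hκ x (argmaxY f x)]
  have h3 := mul_le_mul h1 h2 (norm_nonneg _) ((norm_nonneg _).trans h1)
  have h4 := mul_innerTol_le (ρ := ρ) (M := M) (ε := ε) hℓ
  have hM' := hf.le_M hκ hM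
  have hε : 0 ≤ ε := by
    have : 0 ≤ innerTol ℓ ρ M ε := (norm_nonneg _).trans hy
    have : 0 ≤ ℓ * innerTol ℓ ρ M ε := by positivity
    linarith
  rw [le_div_iff₀ (by norm_num)]
  refine Real.le_sqrt_of_sq_le ?_
  have h5 := mul_le_mul_of_nonneg_left h4 (show 0 ≤ 16 * κ ^ 3 * ρ by positivity)
  have h6 := mul_le_mul_of_nonneg_right hM' hε
  have h7 : 0 ≤ κ ^ 3 * ρ * ε := by positivity
  nlinarith

include hs

/-- Sufficient decrease. Write `u = M ‖s‖ / (κ ℓ)`. The cubic model gives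
`P(x + s) - P(x) ≤ -½ ⟨s, S s⟩ - (M / 3) ‖s‖³ + ½ ⟨s, (∇²P - S) s⟩ + (M / 48) ‖s‖³`. If `u` is
small, then `S ⪰ -(M / 2) ‖s‖` and the error of `S` is negligible; for moderate `u` the bound
`S ⪰ -ℓ` is better; for large `u` all quadratic terms are at most `κ ℓ ‖s‖²` up to a constant and
are dominated by the cubic one. -/
theorem primal_add_le_sub (hlarge : ε ≤ 4 * M * ‖s‖ ^ 2) (hs0 : s ≠ 0) :
    primal f (x + s) ≤ primal f x - M / 24 * ‖s‖ ^ 3 := by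
  have hk := hf.kappa_ge hκ
  have hρ := hf.rho_pos
  have hℓ := hf.ell_pos
  have hMpos := hf.M_pos hκ hM
  have hn : 0 < ‖s‖ := norm_pos_iff.2 hs0
  have hsymm := hf.schur_symm x y
  have hst := cubicModel_stationary hsymm hs
  have hmodel := cubicModel_eq hst
  rw [cubicModel] at hmodel
  have F2 := cubicModel_curvature hsymm hs s
  have F3 := hf.neg_ell_le_inner_schur x y s
  have F5 := (abs_le.1 (inner_clm_le (hf.norm_schur_le' hκ x (argmaxY f x)) s)).2
  have F6 := hf.primal_add_le hκ hM x s
  have F1 : inner ℝ (gradX f x (argmaxY f x)) s ≤ inner ℝ (gradX f x y) s + M / 48 * ‖s‖ ^ 3 := by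
    have h1 := (abs_le.1 (abs_real_inner_le_norm
      (gradX f x y - gradX f x (argmaxY f x)) s)).1
    have h2 := hf.norm_gradX_sub_argmaxY_le hy
    rw [inner_sub_left] at h1
    nlinarith
  have F4 : inner ℝ s (schur f x (argmaxY f x) s) - inner ℝ s (schur f x y s) ≤
      4 * κ ^ 2 * ρ * innerTol ℓ ρ M ε * ‖s‖ ^ 2 := by
    have h1 := (abs_le.1 (inner_clm_le ((hf.norm_schur_sub_argmaxY_le hκ x y).trans
      (mul_le_mul_of_nonneg_left hy (by positivity))) s)).1
    rw [_root_.sub_apply, inner_sub_right] at h1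
    linarith
  set A := inner ℝ s (schur f x y s)
  set B := inner ℝ s (schur f x (argmaxY f x) s)
  set n := ‖s‖
  set u := M * n / (κ * ℓ) with hu
  set W := κ * ℓ * n ^ 2 with hW
  have hu0 : 0 < u := by positivity
  have hW0 : 0 < W := by positivity
  have hMn : M * n ^ 3 = u * W := by rw [hu, hW]; field_simp
  have G2 : -(u * W / 2) ≤ A := by rw [← hMn]; linarith
  have G3 : -W ≤ A := by
    refine le_trans ?_ F3
    rw [hW]
    nlinarith [mul_pos hℓ (pow_pos hn 2)]
  have G4 : B - A ≤ u ^ 2 * W * (5 / 336) := by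
    refine F4.trans ?_
    have h1 : innerTol ℓ ρ M ε ≤ M * n ^ 2 / (48 * ℓ) := by
      rw [le_div_iff₀ (by positivity)]
      have := mul_innerTol_le (ρ := ρ) (M := M) (ε := ε) hℓ
      linarith
    have h2 : u ^ 2 * W = M * M * n ^ 4 / (κ * ℓ) := by rw [hu, hW]; field_simp
    have h3 : 4 * κ ^ 2 * ρ * (M * n ^ 2 / (48 * ℓ)) * n ^ 2 =
        (28 / 5 * κ ^ 3 * ρ) * M * n ^ 4 / (κ * ℓ) * (5 / 336) := by field_simp; norm_num
    calc _ ≤ 4 * κ ^ 2 * ρ * (M * n ^ 2 / (48 * ℓ)) * n ^ 2 := by gcongr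
      _ ≤ _ := by
        rw [h2, h3]
        gcongr
        exact hf.le_M hκ hM
  have G5 : B ≤ 2 * W := by rw [hW]; linarith
  -- `13/48 = 1/3 - 1/48 - 1/24`. The thresholds `14/5` and `8` separate the three ranges of `u`;
  -- `14/5` is a rational stand-in for `2 √2`, where the error of `S` reaches `u W / 24`.
  have goal : -(1 / 2) * A + 1 / 2 * (B - A) ≤ 13 / 48 * (u * W) := by
    have huW : 0 < u * W := by positivity
    rcases le_total u (14 / 5) with h | h
    · have : u ^ 2 * W ≤ 14 / 5 * (u * W) := by nlinarith
      linarith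
    · rcases le_total u 8 with h' | h'
      · have h1 : u ^ 2 * W ≤ 8 * (u * W) := by nlinarith
        have h2 : 14 / 5 * W ≤ u * W := by gcongr
        linarith
      · have h2 : 8 * W ≤ u * W := by gcongr
        linarith
  rw [← hMn] at goal
  linarith

/-- A short step ends at an approximate second-order stationary point of the primal function;
here `b` stands for `√(ε / M)`. -/
theorem stationary_of_short_step {b : ℝ} (hb : 0 ≤ b) (hεb : ε = M * b ^ 2)
    (hshort : ‖s‖ ≤ 1 / 2 * b) :
    ‖gradX f (x + s) (argmaxY f (x + s))‖ ≤ ε ∧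
      ∀ v, -(7 / 8 * (M * b)) * ‖v‖ ^ 2 ≤
        inner ℝ v (schur f (x + s) (argmaxY f (x + s)) v) := by
  have hMpos := hf.M_pos hκ hM
  have hE : ‖schur f x y - schur f x (argmaxY f x)‖ ≤ M * b / 8 := by
    have := hf.norm_schur_sub_le_sqrt hκ hM hy
    rwa [hεb, show M * (M * b ^ 2) = (M * b) ^ 2 by ring, Real.sqrt_sq (by positivity)] at this
  have hsymm := hf.schur_symm x y
  have hst := cubicModel_stationary hsymm hs
  constructor
  · have e : gradX f (x + s) (argmaxY f (x + s)) =
        (gradX f (x + s) (argmaxY f (x + s)) - gradX f x (argmaxY f x) -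
          schur f x (argmaxY f x) s) - (gradX f x y - gradX f x (argmaxY f x)) -
        (schur f x y - schur f x (argmaxY f x)) s - (M / 2 * ‖s‖) • s := by
      have : gradX f x y = -(schur f x y s) - (M / 2 * ‖s‖) • s := by
        rw [← sub_eq_zero, ← hst]; abel
      rw [this, _root_.sub_apply]
      abel
    have h1 := hf.norm_grad_primal_add_sub_le hκ hM x s
    have h2 := hf.norm_gradX_sub_argmaxY_le hy
    have h3 := (schur f x y - schur f x (argmaxY f x)).le_of_opNorm_le hE s
    have h4 : ‖(M / 2 * ‖s‖) • s‖ = M / 2 * ‖s‖ ^ 2 := by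
      rw [norm_smul, Real.norm_of_nonneg (by positivity)]; ring
    rw [e]
    refine (norm_sub_le _ _).trans ?_
    rw [h4]
    have h5 := norm_sub_le (gradX f (x + s) (argmaxY f (x + s)) - gradX f x (argmaxY f x) -
      schur f x (argmaxY f x) s - (gradX f x y - gradX f x (argmaxY f x)))
      ((schur f x y - schur f x (argmaxY f x)) s)
    have h6 := norm_sub_le (gradX f (x + s) (argmaxY f (x + s)) - gradX f x (argmaxY f x) -
      schur f x (argmaxY f x) s) (gradX f x y - gradX f x (argmaxY f x))
    have h7 : M * ‖s‖ ^ 2 ≤ M * (1 / 2 * b) ^ 2 := by gcongr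
    have h8 : M * b / 8 * ‖s‖ ≤ M * b / 8 * (1 / 2 * b) := by gcongr
    have h9 : 0 ≤ M * b ^ 2 := by positivity
    linarith
  · intro v
    have h1 := cubicModel_curvature hsymm hs v
    have h2 := (abs_le.1 (inner_clm_le hE v)).2
    have h3 := hf.norm_hess_primal_sub_le hκ hM (x + s) x
    rw [add_sub_cancel_left] at h3
    have h4 := (abs_le.1 (inner_clm_le h3 v)).1
    rw [_root_.sub_apply, inner_sub_right] at h2 h4
    have h5 : M * ‖s‖ * ‖v‖ ^ 2 ≤ M * (1 / 2 * b) * ‖v‖ ^ 2 := by gcongr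
    linarith

end Step

/-! ### Runs of MCN -/

section Run

variable {x₀ : Euc dx} {T t : ℕ} {x s : ℕ → Euc dx} {y : ℕ → Euc dy} {ε : ℝ} (hε : 0 < ε)
  (hrun : IsMCNRun f ℓ κ M x₀ T (mcnSteps κ (innerTol ℓ ρ M ε) ‖argmaxY f x₀‖ s) ε t x y s)
include hε hrun

/-- All inner loops reach their accuracy: `y_i` is a good starting point for round `i + 1`, as `y*`
is `κ`-Lipschitz. -/
theorem run_accuracy : ∀ i ≤ t, ‖y i - argmaxY f (x i)‖ ≤ innerTol ℓ ρ M ε := by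
  have hτ := innerTol_pos hf.ell_pos hf.rho_pos (hf.M_pos hκ hM) hε
  intro i
  induction i with
  | zero =>
    intro _
    rw [hrun.y_zero]
    refine hf.norm_agdMax_sub_le hκ _ hτ (R := ‖argmaxY f x₀‖) ?_ (Nat.le_ceil _)
    rw [hrun.x_zero, zero_sub, norm_neg]
  | succ i ih =>
    intro hi
    rw [hrun.y_succ i hi]
    refine hf.norm_agdMax_sub_le hκ _ hτ (R := innerTol ℓ ρ M ε + κ * ‖s i‖) ?_ (Nat.le_ceil _)
    refine (norm_sub_le_norm_sub_add_norm_sub _ (argmaxY f (x i)) _).trans ?_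
    refine add_le_add (ih (by omega)) ?_
    have := hf.norm_argmaxY_sub_le (x i) (x (i + 1))
    rwa [hrun.x_succ i hi, norm_sub_rev (x i), add_sub_cancel_left, ← hκ,
      ← hrun.x_succ i hi] at this

/-- A step that does not end the loop decreases the primal function by `ε^{3/2} / (192 √M)`, which
is written with `b = √(ε / M)` here. -/
theorem run_decrease {i : ℕ} (hi : i ≤ t) (hlong : ¬ ‖s i‖ ≤ 1 / 2 * √(ε / M)) :
    primal f (x i + s i) ≤ primal f (x i) - M * √(ε / M) ^ 3 / 192 := by
  have hMpos := hf.M_pos hκ hM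
  set b := √(ε / M) with hb
  have hb0 : 0 < b := Real.sqrt_pos.2 (by positivity)
  have hbε : M * b ^ 2 = ε := by
    rw [hb, Real.sq_sqrt (by positivity)]; field_simp
  push Not at hlong
  have hpos : 0 < ‖s i‖ := by linarith
  have h1 := hf.primal_add_le_sub hκ hM (hf.run_accuracy hκ hM hε hrun i hi) (hrun.cubic i hi) ?_
    (norm_pos_iff.1 hpos)
  · have h2 : M * (1 / 2 * b) ^ 3 ≤ M * ‖s i‖ ^ 3 := by gcongr
    linarith
  · have h2 : M * (1 / 2 * b) ^ 2 ≤ M * ‖s i‖ ^ 2 := by gcongr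
    linarith

theorem run_primal_le : ∀ i ≤ t, primal f (x i) ≤ primal f x₀ - i * (M * √(ε / M) ^ 3 / 192) := by
  intro i
  induction i with
  | zero => intro _; simp [hrun.x_zero]
  | succ i ih =>
    intro hi
    have h := hf.run_decrease hκ hM hε hrun (by omega) (hrun.no_break i hi)
    rw [hrun.x_succ i hi]
    push_cast
    linarith [ih (by omega)]

/-- The loop ends with a short step: `T` long steps would bring the primal function below its
infimum. -/
theorem run_short_step (hbdd : PrimalBddBelow f)
    (hT : T = ⌈192 * (primal f x₀ - primalInf f) * √M * ε ^ (-(3 / 2) : ℝ)⌉₊ + 1) :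
    ‖s t‖ ≤ 1 / 2 * √(ε / M) := by
  by_contra hlong
  have hMpos := hf.M_pos hκ hM
  have hTt := hrun.leave.resolve_left hlong
  have h1 := hf.run_decrease hκ hM hε hrun le_rfl hlong
  have h2 := hf.run_primal_le hκ hM hε hrun t le_rfl
  have h3 : primalInf f ≤ primal f (x t + s t) := ciInf_le hbdd _
  have h4 : 192 * (primal f x₀ - primalInf f) * √M * ε ^ (-(3 / 2) : ℝ) < T := by
    rw [hT]
    push_cast
    exact (Nat.le_ceil _).trans_lt (lt_add_one _)
  have h5 : √M * ε ^ (-(3 / 2) : ℝ) * (M * √(ε / M) ^ 3) = 1 := by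
    have hm := Real.sqrt_pos.2 hMpos
    have he := Real.sqrt_pos.2 hε
    have e1 : ε ^ (-(3 / 2) : ℝ) = (√ε ^ 3)⁻¹ := by
      rw [Real.rpow_neg hε.le, Real.sqrt_eq_rpow, ← Real.rpow_natCast, ← Real.rpow_mul hε.le]
      norm_num
    have e2 : M = √M ^ 2 := (Real.sq_sqrt hMpos.le).symm
    rw [e1, Real.sqrt_div hε.le]
    nth_rewrite 2 [e2]
    field_simp
  have hc : 0 < M * √(ε / M) ^ 3 / 192 := by
    have : 0 < √(ε / M) := Real.sqrt_pos.2 (by positivity)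
    positivity
  have h6 := mul_lt_mul_of_pos_right h4 hc
  have h7 : 192 * (primal f x₀ - primalInf f) * √M * ε ^ (-(3 / 2) : ℝ) *
      (M * √(ε / M) ^ 3 / 192) = primal f x₀ - primalInf f := by
    linear_combination (primal f x₀ - primalInf f) * h5
  rw [h7, ← hTt] at h6
  push_cast at h6
  linarith

end Run

end IsNCSC

end MinimaxCubic

/-! ### The strict-minimax condition at the output -/

theorem mainTheorem4 {dx dy : ℕ} (hdy : 0 < dy) (f : Euc dx → Euc dy → ℝ)
    (ℓ ρ μ : ℝ) (hℓ : 0 < ℓ) (hρ : 0 < ρ) (hμ : 0 < μ)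
    (hf : TwiceDifferentiable f) (hgrad : LipschitzGrad f ℓ) (hhess : LipschitzHess f ρ)
    (hconc : StronglyConcaveInY f μ) (hbdd : PrimalBddBelow f)
    (α β γ : ℝ) (hstrict : StrictMinimax f α β γ)
    (κ M ε ε' : ℝ) (hκ : κ = ℓ / μ) (hM : M = 4 * √2 * κ ^ 3 * ρ)
    (hε : ε = min (α / 3) (β ^ 2 / (8 * κ ^ 3 * ρ)))
    (hε' : ε' = (2 : ℝ) ^ (-(5 / 2) : ℝ) * ε)
    (x₀ : Euc dx) (T : ℕ)
    (hT : T = ⌈192 * (primal f x₀ - primalInf f) * √M * ε' ^ (-(3 / 2) : ℝ)⌉₊ + 1)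
    (t : ℕ) (x : ℕ → Euc dx) (y : ℕ → Euc dy) (s : ℕ → Euc dx)
    (hrun : IsMCNRun f ℓ κ M x₀ T
      (mcnSteps κ (innerTol ℓ ρ M ε') ‖argmaxY f x₀‖ s) ε' t x y s)
    (Khat : ℕ)
    (hKhat : Khat = ⌈2 * √κ * Real.log (√(κ + 1) *
      (innerTol ℓ ρ M ε + κ / (2 : ℝ) ^ (9 / 4 : ℝ) * √(ε / M)) /
        min (α / (2 * ℓ)) (β / (8 * κ ^ 2 * ρ)))⌉₊)
    (xhat : Euc dx) (hxhat : xhat = x t + s t)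
    (yhat : Euc dy) (hyhat : yhat = agdMax f ℓ κ xhat (y t) Khat) :
    ∃ (xs : Euc dx) (ys : Euc dy), IsLocalMinimax f xs ys ∧
      ‖xs - xhat‖ ^ 2 + ‖ys - yhat‖ ^ 2 ≤ γ ^ 2 := by
  obtain ⟨hα, hβ, -, hstrict⟩ := hstrict
  have hN : IsNCSC f ℓ ρ μ := ⟨hdy, hℓ, hρ, hμ, hf, hgrad, hhess, hconc⟩
  have hk : 1 ≤ κ := hN.kappa_ge hκ
  have hMpos : 0 < M := hN.M_pos hκ hM
  have hεpos : 0 < ε := by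
    rw [hε]
    exact lt_min (by positivity) (by positivity)
  set q : ℝ := (2 : ℝ) ^ (-(5 / 2) : ℝ) with hq
  have hq0 : 0 < q := by positivity
  have hε'pos : 0 < ε' := by rw [hε']; positivity
  -- `M` and the factor `2^{-5/2}` are matched: `M ε' = κ³ ρ ε`.
  have hq2 : 4 * √2 * q = 1 := by
    have h4 : (4 : ℝ) = 2 ^ (2 : ℝ) := by norm_num
    rw [hq, Real.sqrt_eq_rpow, h4, ← Real.rpow_add two_pos, ← Real.rpow_add two_pos]
    norm_num
  have hMε' : M * ε' = κ ^ 3 * ρ * ε := by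
    rw [hM, hε']
    linear_combination (κ ^ 3 * ρ * ε) * hq2
  have hεα : ε ≤ α / 3 := hε ▸ min_le_left _ _
  have hεβ : 8 * (κ ^ 3 * ρ * ε) ≤ β ^ 2 := by
    have h : ε ≤ β ^ 2 / (8 * κ ^ 3 * ρ) := hε ▸ min_le_right _ _
    rw [le_div_iff₀ (by positivity)] at h
    linarith
  have hq1 : q ≤ 1 := Real.rpow_le_one_of_one_le_of_nonpos one_le_two (by norm_num)
  have hεε' : ε' ≤ ε := by
    rw [hε']
    nlinarith
  have hacc := hN.run_accuracy hκ hM hε'pos hrun t le_rfl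
  have hshort := hN.run_short_step hκ hM hε'pos hrun hbdd hT
  set b := √(ε' / M) with hb
  have hb0 : 0 ≤ b := Real.sqrt_nonneg _
  have hbε : ε' = M * b ^ 2 := by
    rw [hb, Real.sq_sqrt (by positivity)]; field_simp
  have hMb : M * b ≤ β / 2 := by
    refine abs_le_of_sq_le_sq' ?_ (by positivity) |>.2
    have : (M * b) ^ 2 = M * ε' := by rw [hbε]; ring
    rw [this, hMε']
    nlinarith [sq_nonneg β]
  obtain ⟨hfirst, hsecond⟩ := hN.stationary_of_short_step hκ hM hacc (hrun.cubic t le_rfl) hb0 hbε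
    hshort
  rw [← hxhat] at hfirst hsecond
  set σ := min (α / (2 * ℓ)) (β / (8 * κ ^ 2 * ρ)) with hσ
  have hσ0 : 0 < σ := lt_min (by positivity) (by positivity)
  have hσα : ℓ * σ ≤ α / 2 := by
    have h : σ ≤ α / (2 * ℓ) := min_le_left _ _
    rw [le_div_iff₀ (by positivity)] at h
    linarith
  have hσβ : 4 * κ ^ 2 * ρ * σ ≤ β / 2 := by
    have h : σ ≤ β / (8 * κ ^ 2 * ρ) := min_le_right _ _
    rw [le_div_iff₀ (by positivity)] at h
    linarith
  have hyacc : ‖yhat - argmaxY f xhat‖ ≤ σ := by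
    rw [hyhat]
    refine hN.norm_agdMax_sub_le hκ _ hσ0
      (R := innerTol ℓ ρ M ε + κ / (2 : ℝ) ^ (9 / 4 : ℝ) * √(ε / M)) ?_ ?_
    · refine (norm_sub_le_norm_sub_add_norm_sub _ (argmaxY f (x t)) _).trans (add_le_add
        (hacc.trans (innerTol_mono hℓ hρ hMpos hεε')) ?_)
      have h1 := hN.norm_argmaxY_sub_le (x t) xhat
      rw [← hκ, hxhat, norm_sub_rev (x t), add_sub_cancel_left, ← hxhat] at h1
      -- `½ √(2^{-5/2}) = 2^{-9/4}`
      have h2 : 1 / 2 * b = 1 / (2 : ℝ) ^ (9 / 4 : ℝ) * √(ε / M) := by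
        have h3 : √q = (2 : ℝ) ^ (-(5 / 4) : ℝ) := by
          rw [hq, Real.sqrt_eq_rpow, ← Real.rpow_mul zero_le_two]
          norm_num
        have h4 : (2 : ℝ) ^ (-(5 / 4) : ℝ) = 2 * (1 / (2 : ℝ) ^ (9 / 4 : ℝ)) := by
          rw [one_div, ← Real.rpow_neg zero_le_two, ← Real.rpow_one_add' zero_le_two (by norm_num)]
          norm_num
        rw [hb, hε', mul_div_assoc, Real.sqrt_mul hq0.le, h3, h4]
        ring
      calc _ ≤ κ * (1 / 2 * b) := h1.trans (by gcongr)
        _ = _ := by rw [h2]; ring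
    · rw [hKhat, div_mul_eq_mul_div]
      exact Nat.le_ceil _
  have hnotgrad : ¬ α < ‖grad f xhat yhat‖ := by
    have h1 : ‖grad f xhat yhat - grad f xhat (argmaxY f xhat)‖ ≤ ℓ * σ := by
      refine (le_mul_of_sq_le hℓ.le (norm_nonneg _) ?_).trans
        (mul_le_mul_of_nonneg_left hyacc hℓ.le)
      simpa using hgrad xhat xhat yhat (argmaxY f xhat)
    have h2 : ‖grad f xhat (argmaxY f xhat)‖ ≤ ε' := by
      rw [← sq_le_sq₀ (norm_nonneg _) hε'pos.le, norm_sq_joint]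
      have h3 : (grad f xhat (argmaxY f xhat)).snd = 0 := hN.gradY_argmaxY xhat
      rw [h3, norm_zero, zero_pow two_ne_zero, add_zero]
      exact pow_le_pow_left₀ (norm_nonneg _) hfirst 2
    have h3 := norm_le_norm_add_norm_sub' (grad f xhat yhat) (grad f xhat (argmaxY f xhat))
    linarith
  have hnotcurv : ¬ lambdaMin (schur f xhat yhat) < -β := by
    refine not_lt.2 (le_lambdaMin (by linarith) fun v => ?_)
    have h1 := (abs_le.1 (inner_clm_le ((hN.norm_schur_sub_argmaxY_le hκ xhat yhat).trans
      (mul_le_mul_of_nonneg_left hyacc (by positivity))) v)).1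
    rw [_root_.sub_apply, inner_sub_right] at h1
    have h2 := hsecond v
    have h3 : 4 * κ ^ 2 * ρ * σ * ‖v‖ ^ 2 ≤ β / 2 * ‖v‖ ^ 2 := by gcongr
    have h4 : M * b * ‖v‖ ^ 2 ≤ β / 2 * ‖v‖ ^ 2 := by gcongr
    have h5 : 0 ≤ M * b * ‖v‖ ^ 2 := by positivity
    linarith
  obtain ⟨xs, ys, hloc, hdist⟩ := ((hstrict xhat yhat).resolve_left hnotgrad).resolve_left hnotcurv
  refine ⟨xs, ys, hloc, ?_⟩
  rwa [norm_sub_rev xs, norm_sub_rev ys]
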